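/- **Setting.** Let $\Omega\subset\mathbb R^3$ be a bounded open set with Lipschitz boundary; $\langle\cdot,\cdot\rangle$ and $\|\cdot\|$ are the inner product and norm of $L^2(\Omega)$ or $L^2(\Omega)^3$. Let $\mathcal H^{DC}_0$ be the space of all $v\in H(\mathrm{div},\Omega)\cap H(\mathrm{curl},\Omega)$ whose normal and tangential traces vanish on $\partial\Omega$ (full homogeneous Dirichlet conditions), with $\|v\|_{DC}^2=\|v\|^2+\|\nabla\cdot v\|^2+\|\nabla\times v\|^2$. Let $V_h\subset\mathcal H^{DC}_0$ be a finite-element space, that is, a finite-dimensional subspace consisting of essentially bounded fields. Let $K_1\ge0$, $K_3>0$, $\zeta>0$, $0<\alpha\le1\le\beta$. For $K_2\in\mathbb R$ put $\kappa=K_2/K_3$ and $Z(n)=\kappa\,n\otimes n+(I-n\otimes n)$. The current iterate $n_k\in H(\mathrm{div},\Omega)\cap H(\mathrm{curl},\Omega)$ (with any Dirichlet data) is assumed to satisfy $\alpha\le|n_k|^2\le\beta$ almost everywhere in $\Omega$, and $Z(n_k)$ is assumed to be uniformly symmetric positive definite: its Rayleigh quotient lies almost everywhere between constants $\eta>0$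 and $\Lambda$. The Newton linearization at $n_k$ of the penalty functional $\mathcal P(n)=K_1\|\nabla\cdot n\|^2+K_3\langle Z(n)\nabla\times n,\nabla\times n\rangle+\zeta\|n\cdot n-1\|^2$, divided by $2$, is the discrete problem $$\text{find }\delta n_h\in V_h:\qquad a(\delta n_h,v_h)=F(v_h)\quad\text{for all }v_h\in V_h,\tag{1}$$ where $$\begin{aligned}a(u,v)&=\hat a(u,v)+2\zeta\big(\langle n_k\cdot n_k-1,u\cdot v\rangle+2\langle u\cdot n_k,v\cdot n_k\rangle\big),\\ \hat a(u,v)&=K_1\langle\nabla\cdot u,\nabla\cdot v\rangle+K_3\langle Z(n_k)\nabla\times u,\nabla\times v\rangle+(K_2-K_3)\big(\langle u\cdot\nabla\times v,n_k\cdot\nabla\times n_k\rangle\\ &\quad+\langle n_k\cdot\nabla\times v,u\cdot\nabla\times n_k\rangle+\langle n_k\cdot\nabla\times n_k,v\cdot\nabla\times u\rangle+\langle n_k\cdot\nabla\times u,v\cdot\nabla\times n_k\rangle+\langle u\cdot\nabla\times n_k,v\cdot\nabla\times n_k\rangle\big),\\ F(v)&=-K_1\langle\nabla\cdot n_k,\nabla\cdot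 v\rangle-K_3\langle Z(n_k)\nabla\times n_k,\nabla\times v\rangle-(K_2-K_3)\langle n_k\cdot\nabla\times n_k,v\cdot\nabla\times n_k\rangle-2\zeta\langle v\cdot n_k,n_k\cdot n_k-1\rangle.\end{aligned}$$ Problem (1) is called *well-posed* if, with respect to $\|\cdot\|_{DC}$ on $V_h$, $F$ is a bounded linear functional, $a$ is a bounded and coercive bilinear form, (1) has exactly one solution, and for every bounded linear functional $G$ on $V_h$ the problem $a(u,\cdot)=G$ has exactly one solution $u\in V_h$, which satisfies $\|u\|_{DC}\le S\|G\|$ with $S$ independent of $G$. **Theorem.** There is a constant $C>0$ with $\|v\|^2\le C(\|\nabla\cdot v\|^2+\|\nabla\times v\|^2)$ for all $v\in\mathcal H^{DC}_0$; and if $K_1>0$ and $K_2=K_3$, there is a constant $\alpha_0>0$, independent of $n_k$, with $\alpha_0\|v\|_{DC}^2\le\hat a(v,v)$ for all $v\in\mathcal H^{DC}_0$. Moreover: (i) Let $\kappa=1$ and let $\alpha_0>0$ be any constant with $\alpha_0\|v\|_{DC}^2\le\hat a(v,v)$ for all $v\in V_h$. If $2\zeta|\alpha-1|<\alpha_0$,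 then (1) is well-posed. (ii) Let $C>0$ be any constant with $\|v\|^2\le C(\|\nabla\cdot v\|^2+\|\nabla\times v\|^2)$ for all $v\in V_h$. If $$\beta_1=\frac{\min(K_1,K_3)}{C+1}-2\zeta|\alpha-1|>0,$$ then for every $R$ there are $\varepsilon_1,\varepsilon_2>0$, depending on $n_k$ only through $\beta$ and $R$ (and otherwise on $\Omega,V_h,K_1,K_3,\zeta,\alpha,C$), such that (1) is well-posed whenever $\kappa\in(1-\varepsilon_2,1+\varepsilon_1)$ and $\|\nabla\times n_k\|\le R$. -/

import Mathlib

open MeasureTheory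
open scoped ContDiff Matrix ENNReal NNReal

noncomputable section

namespace PenaltyNewton

/-- Euclidean three-space. -/
abbrev E3 : Type := EuclideanSpace ℝ (Fin 3)

/-- `L²(Ω)`. -/
abbrev L2Scalar (Ω : Set E3) : Type := Lp ℝ 2 (volume.restrict Ω)

/-- `L²(Ω)³`. -/
abbrev L2Field (Ω : Set E3) : Type := Lp E3 2 (volume.restrict Ω)

/-- Near each of its boundary points, and in suitable Cartesian coordinates (a rigid motion `T`),
`Ω` is the set of points lying above the graph of a Lipschitz function of two variables. -/
def HasLipschitzBoundary (Ω : Set E3) : Prop :=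
  ∀ p ∈ frontier Ω, ∃ (T : E3 ≃ᵃⁱ[ℝ] E3) (γ : EuclideanSpace ℝ (Fin 2) → ℝ) (L : ℝ≥0) (r : ℝ),
    0 < r ∧ LipschitzWith L γ ∧
      ∀ x ∈ Metric.ball p r, (x ∈ Ω ↔ γ !₂[T x 0, T x 1] < T x 2)

/-- The partial derivative `∂ψⱼ/∂xᵢ` of a differentiable field. -/
def partialDeriv (i j : Fin 3) (ψ : E3 → E3) (x : E3) : ℝ :=
  (fderiv ℝ ψ x (EuclideanSpace.single i 1)) j

/-- The classical curl of a differentiable field. -/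
def curl (ψ : E3 → E3) (x : E3) : E3 :=
  !₂[partialDeriv 1 2 ψ x - partialDeriv 2 1 ψ x,
     partialDeriv 2 0 ψ x - partialDeriv 0 2 ψ x,
     partialDeriv 0 1 ψ x - partialDeriv 1 0 ψ x]

/-- Green's formula `∫_Ω d φ = - ∫_Ω v · ∇φ` for all smooth `φ` with compact support in `U`
(`v · ∇φ` is the derivative of `φ` in the direction `v`). With `U = Ω` it says that `d` is the weak
divergence of `v` in `Ω`; with `U` the whole space there is, in addition, no boundary term, that is,
the normal trace of `v` on `∂Ω` vanishes. -/
def GreenDiv (Ω U : Set E3) (v : L2Field Ω) (d : L2Scalar Ω) : Prop :=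
  ∀ φ : E3 → ℝ, ContDiff ℝ ∞ φ → HasCompactSupport φ → tsupport φ ⊆ U →
    ∫ x in Ω, d x * φ x = - ∫ x in Ω, fderiv ℝ φ x (v x)

/-- Green's formula `∫_Ω w · ψ = ∫_Ω v · curl ψ` for all smooth fields `ψ` with compact support in
`U`. With `U = Ω` it says that `w` is the weak curl of `v` in `Ω`; with `U` the whole space there
is, in addition, no boundary term, that is, the tangential trace of `v` on `∂Ω` vanishes. -/
def GreenCurl (Ω U : Set E3) (v w : L2Field Ω) : Prop :=
  ∀ ψ : E3 → E3, ContDiff ℝ ∞ ψ → HasCompactSupport ψ → tsupport ψ ⊆ U →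
    ∫ x in Ω, inner ℝ (w x) (ψ x) = ∫ x in Ω, inner ℝ (v x) (curl ψ x)

/-- The space `H(div, Ω) ∩ H(curl, Ω)`. -/
def HDC (Ω : Set E3) : Set (L2Field Ω) :=
  {v | (∃ d : L2Scalar Ω, GreenDiv Ω Ω v d) ∧ ∃ w : L2Field Ω, GreenCurl Ω Ω v w}

open Classical in
/-- The weak divergence of `v` (zero if `v` has none in `L²`). -/
def weakDiv (Ω : Set E3) (v : L2Field Ω) : L2Scalar Ω :=
  if h : ∃ d : L2Scalar Ω, GreenDiv Ω Ω v d then h.choose else 0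

open Classical in
/-- The weak curl of `v` (zero if `v` has none in `L²`). -/
def weakCurl (Ω : Set E3) (v : L2Field Ω) : L2Field Ω :=
  if h : ∃ w : L2Field Ω, GreenCurl Ω Ω v w then h.choose else 0

/-- The fields of `H(div, Ω) ∩ H(curl, Ω)` with homogeneous full Dirichlet boundary conditions: both
the normal and the tangential trace vanish on `∂Ω`. -/
def HDC0 (Ω : Set E3) : Set (L2Field Ω) :=
  {v | v ∈ HDC Ω ∧ GreenDiv Ω Set.univ v (weakDiv Ω v) ∧ GreenCurl Ω Set.univ v (weakCurl Ω v)}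

/-- The norm `(‖v‖² + ‖div v‖² + ‖curl v‖²)^(1/2)`, with `L²(Ω)` norms. -/
def hdcNorm (Ω : Set E3) (v : L2Field Ω) : ℝ :=
  Real.sqrt (‖v‖ ^ 2 + ‖weakDiv Ω v‖ ^ 2 + ‖weakCurl Ω v‖ ^ 2)

/-- `Z(n) = κ n ⊗ n + (I - n ⊗ n)`. -/
def Zmat (κ : ℝ) (n : E3) : Matrix (Fin 3) (Fin 3) ℝ :=
  κ • Matrix.vecMulVec n.ofLp n.ofLp + (1 - Matrix.vecMulVec n.ofLp n.ofLp)

/-- A matrix field on `Ω` is uniformly symmetric positive definite: it is symmetric and its Rayleigh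
quotient is bounded below by some `η > 0` and above by some `Λ`, almost everywhere. -/
def IsUSPD (Ω : Set E3) (Z : E3 → Matrix (Fin 3) (Fin 3) ℝ) : Prop :=
  ∃ η Λ : ℝ, 0 < η ∧ ∀ᵐ x ∂(volume.restrict Ω), (Z x).IsSymm ∧
    ∀ ξ : Fin 3 → ℝ, η * (ξ ⬝ᵥ ξ) ≤ ξ ⬝ᵥ (Z x *ᵥ ξ) ∧ ξ ⬝ᵥ (Z x *ᵥ ξ) ≤ Λ * (ξ ⬝ᵥ ξ)

/-- The standing assumptions on the current iterate `n`. -/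
structure IsAdmissibleIterate (Ω : Set E3) (α β κ : ℝ) (n : L2Field Ω) : Prop where
  mem : n ∈ HDC Ω
  bounds : ∀ᵐ x ∂(volume.restrict Ω), α ≤ ‖n x‖ ^ 2 ∧ ‖n x‖ ^ 2 ≤ β
  uspd : IsUSPD Ω (fun x => Zmat κ (n x))

/-- The first variation at `n`, in the direction `v`, of the penalty functional
`K₁ ‖div n‖² + K₃ ⟨Z(n) curl n, curl n⟩ + ζ ‖n · n - 1‖²`. -/
def firstVariation (Ω : Set E3) (K₁ K₂ K₃ ζ : ℝ) (n v : L2Field Ω) : ℝ :=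
  2 * K₁ * (∫ x in Ω, weakDiv Ω n x * weakDiv Ω v x)
  + 2 * K₃ * (∫ x in Ω,
      (Zmat (K₂ / K₃) (n x) *ᵥ (weakCurl Ω n x).ofLp) ⬝ᵥ (weakCurl Ω v x).ofLp)
  + 2 * (K₂ - K₃) * (∫ x in Ω,
      inner ℝ (n x) (weakCurl Ω n x) * inner ℝ (v x) (weakCurl Ω n x))
  + 4 * ζ * (∫ x in Ω, inner ℝ (v x) (n x) * (inner ℝ (n x) (n x) - 1))

/-- The second variation of the same functional at `n`, in the directions `v` and `u`. -/
def secondVariation (Ω : Set E3) (K₁ K₂ K₃ ζ : ℝ) (n u v : L2Field Ω) : ℝ :=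
  2 * K₁ * (∫ x in Ω, weakDiv Ω u x * weakDiv Ω v x)
  + 2 * K₃ * (∫ x in Ω,
      (Zmat (K₂ / K₃) (n x) *ᵥ (weakCurl Ω u x).ofLp) ⬝ᵥ (weakCurl Ω v x).ofLp)
  + 2 * (K₂ - K₃) *
    ((∫ x in Ω, inner ℝ (u x) (weakCurl Ω v x) * inner ℝ (n x) (weakCurl Ω n x))
    + (∫ x in Ω, inner ℝ (n x) (weakCurl Ω v x) * inner ℝ (u x) (weakCurl Ω n x))
    + (∫ x in Ω, inner ℝ (n x) (weakCurl Ω n x) * inner ℝ (v x) (weakCurl Ω u x))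
    + (∫ x in Ω, inner ℝ (n x) (weakCurl Ω u x) * inner ℝ (v x) (weakCurl Ω n x))
    + (∫ x in Ω, inner ℝ (u x) (weakCurl Ω n x) * inner ℝ (v x) (weakCurl Ω n x)))
  + 4 * ζ *
    ((∫ x in Ω, (inner ℝ (n x) (n x) - 1) * inner ℝ (v x) (u x))
    + 2 * (∫ x in Ω, inner ℝ (u x) (n x) * inner ℝ (v x) (n x)))

/-- The bilinear form `a` of the Newton linearization. Both sides of the Newton equation are divided
by two, so that `a(u, v) = â(u, v) + 2ζ(⟨n·n - 1, u·v⟩ + 2⟨u·n, v·n⟩)` with `â` as below. -/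
def newtonForm (Ω : Set E3) (K₁ K₂ K₃ ζ : ℝ) (n u v : L2Field Ω) : ℝ :=
  secondVariation Ω K₁ K₂ K₃ ζ n u v / 2

/-- The right-hand side `F` of the Newton linearization, with the same normalization. -/
def newtonRHS (Ω : Set E3) (K₁ K₂ K₃ ζ : ℝ) (n v : L2Field Ω) : ℝ :=
  - firstVariation Ω K₁ K₂ K₃ ζ n v / 2

/-- The part `â` of the bilinear form `a` that does not contain the penalty. -/
def elasticForm (Ω : Set E3) (K₁ K₂ K₃ : ℝ) (n u v : L2Field Ω) : ℝ :=
  newtonForm Ω K₁ K₂ K₃ 0 n u v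

/-- `c` is a coercivity constant of the form `b` on `W`, for the norm `hdcNorm`. -/
def IsCoercivityConst (Ω : Set E3) (W : Set (L2Field Ω)) (b : L2Field Ω → L2Field Ω → ℝ)
    (c : ℝ) : Prop :=
  0 < c ∧ ∀ v ∈ W, c * hdcNorm Ω v ^ 2 ≤ b v v

/-- `C > 0` and `‖v‖² ≤ C (‖div v‖² + ‖curl v‖²)` for all `v` in `W`. -/
def IsFriedrichsConst (Ω : Set E3) (W : Set (L2Field Ω)) (C : ℝ) : Prop :=
  0 < C ∧ ∀ v ∈ W, ‖v‖ ^ 2 ≤ C * (‖weakDiv Ω v‖ ^ 2 + ‖weakCurl Ω v‖ ^ 2)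

/-- The problem `a(u, v) = F(v)` for all `v ∈ V` is well-posed on `V`: `F` is a bounded linear
functional, `a` is a bounded and coercive bilinear form, there is exactly one solution, and for
every bounded linear right-hand side `G` there is exactly one solution, which depends continuously
on `G`. -/
structure IsWellPosed (Ω : Set E3) (V : Submodule ℝ (L2Field Ω))
    (a : L2Field Ω → L2Field Ω → ℝ) (F : L2Field Ω → ℝ) : Prop where
  rhs_linear : ∃ f : V →ₗ[ℝ] ℝ, ∀ v : V, f v = F v
  rhs_bounded : ∃ M : ℝ, ∀ v ∈ V, |F v| ≤ M * hdcNorm Ω v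
  form_bilinear : ∃ A : V →ₗ[ℝ] V →ₗ[ℝ] ℝ, ∀ u v : V, A u v = a u v
  form_bounded : ∃ M : ℝ, ∀ u ∈ V, ∀ v ∈ V, |a u v| ≤ M * hdcNorm Ω u * hdcNorm Ω v
  form_coercive : ∃ c : ℝ, IsCoercivityConst Ω V a c
  exists_unique : ∃! u : V, ∀ v : V, a u v = F v
  stable : ∃ S : ℝ, ∀ (G : V →ₗ[ℝ] ℝ) (M : ℝ), 0 ≤ M → (∀ v : V, |G v| ≤ M * hdcNorm Ω (v : L2Field Ω)) →
      ∃! u : V, (∀ v : V, a u v = G v) ∧ hdcNorm Ω (u : L2Field Ω) ≤ S * M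

end PenaltyNewton

end

/-!
The analytic core is the Friedrichs inequality for fields `v` whose normal and tangential traces
both vanish. Extended by zero, such a field has divergence `d` and curl `w` in `L²` of the whole
space, and for smooth compactly supported fields the vector identity
`v div v - v × curl v = div (v ⊗ v - |v|²/2 I)`, tested with the position vector `x`, gives
`‖v‖² = 2 ∫ ((x · v) div v - (x × v) · curl v)`.
On a domain in the ball of radius `R` about the origin, the right-hand side is at most
`2R ‖v‖ (‖div v‖ + ‖curl v‖)`, and the inequality follows without compactness, gradients or
regularity of the boundary. For weak derivatives the identity is used in its bilinear form
(`integral_inner_test_eq`), which holds between `v` and a test field `u` because Green's formula may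
be applied with the test functions `x · u` and `x × u`. The choice `u = ρ ⋆ v` has `div u = ρ ⋆ d`
and `curl u = ρ ⋆ w`, and one passes to the limit by the weak convergence of mollifications in `L²`
(`integral_inner_self_eq`).

Well-posedness is the Lax–Milgram theorem in finite dimension (`isWellPosed_of_coercive`):
bilinearity and coercivity imply everything else. Weak divergence and curl are linear because they
are unique, and since `n` and the fields of `V` are essentially bounded, each term of the linearized
forms is an inner product of two `L²`-valued linear maps (`IterateMaps.newtonForm_eq`).

For coercivity, the penalty term costs at most `2ζ|α - 1|` times the squared norm, because
`n · n - 1 ≥ α - 1` and the other part of it is a square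
(`IterateMaps.elasticForm_sub_le_newtonForm`). The terms that carry the factor
`K₂ - K₃ = K₃ (κ - 1)` are bounded by a multiple of the squared norm that depends only on `β`, on
the bound for `curl n` in `L²`, and on the constant that compares the `L^∞` and `L²` norms on `V`
(`IterateMaps.elasticForm_ge`). They are therefore absorbed when `κ` is close to `1`.
-/

namespace PenaltyNewton

/-! ### Weak divergence and weak curl -/

/-- A bounded continuous field may be paired with an integrable function by any continuous bilinear
map. -/
theorem integrable_bilin {F G H : Type*} [NormedAddCommGroup F] [NormedSpace ℝ F]
    [NormedAddCommGroup G] [NormedSpace ℝ G] [NormedAddCommGroup H] [NormedSpace ℝ H]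
    [SecondCountableTopologyEither E3 G] {μ : Measure E3} (B : G →L[ℝ] F →L[ℝ] H) {f : E3 → F}
    (hf : Integrable f μ) {A : E3 → G} (hA : Continuous A) {M : ℝ} (hM : ∀ x, ‖A x‖ ≤ M) :
    Integrable (fun x => B (A x) (f x)) μ := by
  refine (hf.norm.const_mul (‖B‖ * M)).mono' ?_ (Filter.Eventually.of_forall fun x => ?_)
  · exact B.isBoundedBilinearMap.continuous.comp_aestronglyMeasurable
      (hA.aestronglyMeasurable.prodMk hf.1)
  · exact (B.le_opNorm₂ _ _).trans (by gcongr; exact hM x)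

/-- The sum of the diagonal entries, so that `divOf (fderiv ℝ ψ x)` is the classical divergence. -/
noncomputable def divOf : (E3 →L[ℝ] E3) →L[ℝ] ℝ :=
  ∑ i : Fin 3, (EuclideanSpace.proj (𝕜 := ℝ) i).comp
    (ContinuousLinearMap.apply ℝ E3 (EuclideanSpace.single i 1))

theorem divOf_apply (T : E3 →L[ℝ] E3) :
    divOf T = T (EuclideanSpace.single 0 1) 0 + T (EuclideanSpace.single 1 1) 1
      + T (EuclideanSpace.single 2 1) 2 := by
  simp [divOf, Fin.sum_univ_three]

/-- Twice the axial vector of a matrix, so that `curl ψ x = curlOf (fderiv ℝ ψ x)`. -/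
noncomputable def curlOf : (E3 →L[ℝ] E3) →L[ℝ] E3 where
  toFun T := !₂[T (EuclideanSpace.single 1 1) 2 - T (EuclideanSpace.single 2 1) 1,
     T (EuclideanSpace.single 2 1) 0 - T (EuclideanSpace.single 0 1) 2,
     T (EuclideanSpace.single 0 1) 1 - T (EuclideanSpace.single 1 1) 0]
  map_add' S T := by ext i; fin_cases i <;> simp <;> ring
  map_smul' c T := by ext i; fin_cases i <;> simp <;> ring
  cont := by
    have h : ∀ (a : E3) (j : Fin 3), Continuous fun T : E3 →L[ℝ] E3 => T a j := fun a j =>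
      (EuclideanSpace.proj (𝕜 := ℝ) j).continuous.comp (ContinuousLinearMap.apply ℝ E3 a).continuous
    refine (PiLp.continuous_toLp 2 _).comp (continuous_pi fun i => ?_)
    fin_cases i <;> exact (h _ _).sub (h _ _)

theorem curl_eq_curlOf (ψ : E3 → E3) (x : E3) : curl ψ x = curlOf (fderiv ℝ ψ x) := rfl

theorem continuous_curl {ψ : E3 → E3} (hψ : ContDiff ℝ ∞ ψ) : Continuous (curl ψ) :=
  curlOf.continuous.comp (hψ.continuous_fderiv (by simp))

theorem hasCompactSupport_curl {ψ : E3 → E3} (hc : HasCompactSupport ψ) :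
    HasCompactSupport (curl ψ) :=
  (hc.fderiv ℝ).comp_left (g := curlOf) (map_zero curlOf)

section Finite

variable {Ω U : Set E3}

theorem GreenDiv.smul {v : L2Field Ω} {d : L2Scalar Ω} (h : GreenDiv Ω U v d) (c : ℝ) :
    GreenDiv Ω U (c • v) (c • d) := by
  intro φ hφ hc hU
  have e1 : ∫ x in Ω, (c • d) x * φ x = ∫ x in Ω, c * (d x * φ x) := by
    refine integral_congr_ae ?_
    filter_upwards [Lp.coeFn_smul c d] with x hx
    rw [hx, Pi.smul_apply, smul_eq_mul, mul_assoc]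
  have e2 : ∫ x in Ω, fderiv ℝ φ x ((c • v) x) = ∫ x in Ω, c * fderiv ℝ φ x (v x) := by
    refine integral_congr_ae ?_
    filter_upwards [Lp.coeFn_smul c v] with x hx
    rw [hx, Pi.smul_apply, map_smul, smul_eq_mul]
  rw [e1, e2, integral_const_mul, integral_const_mul, h φ hφ hc hU]
  ring

theorem GreenCurl.smul {v w : L2Field Ω} (h : GreenCurl Ω U v w) (c : ℝ) :
    GreenCurl Ω U (c • v) (c • w) := by
  intro ψ hψ hc hU
  have e (a : L2Field Ω) (χ : E3 → E3) : ∫ x in Ω, inner ℝ ((c • a) x) (χ x)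
      = ∫ x in Ω, c * inner ℝ (a x) (χ x) := by
    refine integral_congr_ae ?_
    filter_upwards [Lp.coeFn_smul c a] with x hx
    rw [hx, Pi.smul_apply, real_inner_smul_left]
  rw [e, e, integral_const_mul, integral_const_mul, h ψ hψ hc hU]

theorem greenDiv_weakDiv {v : L2Field Ω} (hv : v ∈ HDC Ω) : GreenDiv Ω Ω v (weakDiv Ω v) := by
  rw [weakDiv, dif_pos hv.1]
  exact hv.1.choose_spec

theorem greenCurl_weakCurl {v : L2Field Ω} (hv : v ∈ HDC Ω) :
    GreenCurl Ω Ω v (weakCurl Ω v) := by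
  rw [weakCurl, dif_pos hv.2]
  exact hv.2.choose_spec

variable [IsFiniteMeasure (volume.restrict Ω)]

theorem integrable_L2 {F : Type*} [NormedAddCommGroup F] (f : Lp F 2 (volume.restrict Ω)) :
    Integrable f (volume.restrict Ω) :=
  (Lp.memLp f).integrable (by norm_num)

theorem integrable_mul_test (d : L2Scalar Ω) {φ : E3 → ℝ} (hφ : ContDiff ℝ ∞ φ)
    (hc : HasCompactSupport φ) : Integrable (fun x => d x * φ x) (volume.restrict Ω) := by
  obtain ⟨M, hM⟩ := hc.exists_bound_of_continuous hφ.continuous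
  exact (integrable_L2 d).mul_bdd (c := M) hφ.continuous.aestronglyMeasurable
    (Filter.Eventually.of_forall hM)

theorem integrable_fderiv_test (v : L2Field Ω) {φ : E3 → ℝ} (hφ : ContDiff ℝ ∞ φ)
    (hc : HasCompactSupport φ) :
    Integrable (fun x => fderiv ℝ φ x (v x)) (volume.restrict Ω) := by
  have h1 : Continuous (fderiv ℝ φ) := hφ.continuous_fderiv (by simp)
  obtain ⟨M, hM⟩ := (hc.fderiv ℝ).exists_bound_of_continuous h1
  exact integrable_bilin (ContinuousLinearMap.id ℝ _) (integrable_L2 v) h1 hM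

theorem integrable_inner_test (v : L2Field Ω) {ψ : E3 → E3} (hψ : Continuous ψ)
    (hc : HasCompactSupport ψ) :
    Integrable (fun x => inner ℝ (v x) (ψ x)) (volume.restrict Ω) := by
  obtain ⟨M, hM⟩ := hc.exists_bound_of_continuous hψ
  exact (integrable_bilin (innerSL ℝ) (integrable_L2 v) hψ hM).congr
    (Filter.Eventually.of_forall fun x => real_inner_comm (v x) (ψ x))

theorem GreenDiv.add {v v' : L2Field Ω} {d d' : L2Scalar Ω} (h : GreenDiv Ω U v d)
    (h' : GreenDiv Ω U v' d') : GreenDiv Ω U (v + v') (d + d') := by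
  intro φ hφ hc hU
  have e1 : ∫ x in Ω, (d + d') x * φ x = ∫ x in Ω, (d x * φ x + d' x * φ x) := by
    refine integral_congr_ae ?_
    filter_upwards [Lp.coeFn_add d d'] with x hx
    rw [hx, Pi.add_apply, add_mul]
  have e2 : ∫ x in Ω, fderiv ℝ φ x ((v + v') x)
      = ∫ x in Ω, (fderiv ℝ φ x (v x) + fderiv ℝ φ x (v' x)) := by
    refine integral_congr_ae ?_
    filter_upwards [Lp.coeFn_add v v'] with x hx
    rw [hx, Pi.add_apply, map_add]
  rw [e1, e2, integral_add (integrable_mul_test d hφ hc) (integrable_mul_test d' hφ hc),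
    integral_add (integrable_fderiv_test v hφ hc) (integrable_fderiv_test v' hφ hc),
    h φ hφ hc hU, h' φ hφ hc hU]
  ring

theorem GreenCurl.add {v v' w w' : L2Field Ω} (h : GreenCurl Ω U v w)
    (h' : GreenCurl Ω U v' w') : GreenCurl Ω U (v + v') (w + w') := by
  intro ψ hψ hc hU
  have e (a b : L2Field Ω) (χ : E3 → E3) : ∫ x in Ω, inner ℝ ((a + b) x) (χ x)
      = ∫ x in Ω, (inner ℝ (a x) (χ x) + inner ℝ (b x) (χ x)) := by
    refine integral_congr_ae ?_
    filter_upwards [Lp.coeFn_add a b] with x hx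
    rw [hx, Pi.add_apply, inner_add_left]
  have hc' := hasCompactSupport_curl hc
  have hψ' := continuous_curl hψ
  rw [e, e, integral_add (integrable_inner_test _ hψ.continuous hc)
    (integrable_inner_test _ hψ.continuous hc), integral_add (integrable_inner_test _ hψ' hc')
    (integrable_inner_test _ hψ' hc'), h ψ hψ hc hU, h' ψ hψ hc hU]

theorem GreenDiv.unique (hΩ : IsOpen Ω) {v : L2Field Ω} {d d' : L2Scalar Ω}
    (h : GreenDiv Ω Ω v d) (h' : GreenDiv Ω Ω v d') : d = d' := by
  have hd := (integrable_L2 d).sub (integrable_L2 d')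
  have key := hΩ.ae_eq_zero_of_integral_contDiff_smul_eq_zero
    (hd.locallyIntegrable.locallyIntegrableOn Ω) (fun g hg hc hU => by
      have e := integral_sub (integrable_mul_test d hg hc) (integrable_mul_test d' hg hc)
      rw [h g hg hc hU, h' g hg hc hU, sub_self] at e
      rw [← e]
      congr 1; ext x
      simp only [Pi.sub_apply, smul_eq_mul]; ring)
  refine Lp.ext ?_
  filter_upwards [key, ae_restrict_mem hΩ.measurableSet] with x hx hxΩ
  exact sub_eq_zero.1 (hx hxΩ)

theorem GreenCurl.unique (hΩ : IsOpen Ω) {v w w' : L2Field Ω}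
    (h : GreenCurl Ω Ω v w) (h' : GreenCurl Ω Ω v w') : w = w' := by
  have key (j : Fin 3) : ∀ᵐ x ∂(volume.restrict Ω), x ∈ Ω → w x j - w' x j = 0 := by
    have hd := ((EuclideanSpace.proj (𝕜 := ℝ) j).integrable_comp (integrable_L2 w)).sub
      ((EuclideanSpace.proj (𝕜 := ℝ) j).integrable_comp (integrable_L2 w'))
    refine hΩ.ae_eq_zero_of_integral_contDiff_smul_eq_zero
      (hd.locallyIntegrable.locallyIntegrableOn Ω) (fun g hg hc hU => ?_)
    have hψ : ContDiff ℝ ∞ fun x => g x • (EuclideanSpace.single j 1 : E3) :=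
      hg.smul contDiff_const
    have hψc : HasCompactSupport fun x => g x • (EuclideanSpace.single j 1 : E3) := hc.smul_right
    have hψU : tsupport (fun x => g x • (EuclideanSpace.single j 1 : E3)) ⊆ Ω :=
      (tsupport_smul_subset_left _ _).trans hU
    have e := integral_sub (integrable_inner_test w hψ.continuous hψc)
      (integrable_inner_test w' hψ.continuous hψc)
    rw [h _ hψ hψc hψU, h' _ hψ hψc hψU, sub_self] at e
    rw [← e]
    congr 1; ext x
    simp [inner_smul_right, EuclideanSpace.inner_single_right]
    ring
  refine Lp.ext ?_
  filter_upwards [key 0, key 1, key 2, ae_restrict_mem hΩ.measurableSet] with x h0 h1 h2 hxΩ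
  ext j
  fin_cases j
  exacts [sub_eq_zero.1 (h0 hxΩ), sub_eq_zero.1 (h1 hxΩ), sub_eq_zero.1 (h2 hxΩ)]

theorem GreenDiv.weakDiv_eq (hΩ : IsOpen Ω) {v : L2Field Ω} {d : L2Scalar Ω}
    (h : GreenDiv Ω Ω v d) : weakDiv Ω v = d := by
  have hv : ∃ d, GreenDiv Ω Ω v d := ⟨d, h⟩
  rw [weakDiv, dif_pos hv]
  exact hv.choose_spec.unique hΩ h

theorem GreenCurl.weakCurl_eq (hΩ : IsOpen Ω) {v w : L2Field Ω}
    (h : GreenCurl Ω Ω v w) : weakCurl Ω v = w := by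
  have hv : ∃ w, GreenCurl Ω Ω v w := ⟨w, h⟩
  rw [weakCurl, dif_pos hv]
  exact hv.choose_spec.unique hΩ h

/-- The weak divergence, as a linear map on a space of fields that have one. -/
noncomputable def weakDivₗ (hΩ : IsOpen Ω) (V : Submodule ℝ (L2Field Ω))
    (hV : (V : Set (L2Field Ω)) ⊆ HDC Ω) : V →ₗ[ℝ] L2Scalar Ω where
  toFun v := weakDiv Ω v
  map_add' u v := ((greenDiv_weakDiv (hV u.2)).add (greenDiv_weakDiv (hV v.2))).weakDiv_eq hΩ
  map_smul' c v := ((greenDiv_weakDiv (hV v.2)).smul c).weakDiv_eq hΩ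

/-- The weak curl, as a linear map on a space of fields that have one. -/
noncomputable def weakCurlₗ (hΩ : IsOpen Ω) (V : Submodule ℝ (L2Field Ω))
    (hV : (V : Set (L2Field Ω)) ⊆ HDC Ω) : V →ₗ[ℝ] L2Field Ω where
  toFun v := weakCurl Ω v
  map_add' u v := ((greenCurl_weakCurl (hV u.2)).add (greenCurl_weakCurl (hV v.2))).weakCurl_eq hΩ
  map_smul' c v := ((greenCurl_weakCurl (hV v.2)).smul c).weakCurl_eq hΩ

end Finite

/-! ### Mollification -/

section Mollify

open Filter Topology ContinuousLinearMap

/-- Mollifications of `f` converge to `f` weakly in `L²`: after an interchange of integrals they are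
mollifications, at the origin, of the continuous correlation function `s ↦ ∫ f(x + s) · g(x) dx`. -/
theorem tendsto_integral_inner_convolution {F : Type*} [NormedAddCommGroup F]
    [InnerProductSpace ℝ F] [CompleteSpace F] {f g : E3 → F} (hf : MemLp f 2) (hg : MemLp g 2)
    (hfi : Integrable f) {φ : ℕ → ContDiffBump (0 : E3)}
    (hφ : Tendsto (fun i => (φ i).rOut) atTop (𝓝 0)) :
    Tendsto (fun i => ∫ x, inner ℝ (convolution ((φ i).normed volume) f (lsmul ℝ ℝ) volume x) (g x))
      atTop (𝓝 (∫ x, inner ℝ (f x) (g x))) := by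
  let T : E3 → C(E3, E3) := fun s => ⟨fun x => x + s, by fun_prop⟩
  have hT : Continuous T := by
    refine ContinuousMap.continuous_of_continuous_uncurry _ ?_
    exact continuous_snd.add continuous_fst
  have hTm : ∀ s, MeasurePreserving (T s) (volume : Measure E3) volume :=
    fun s => measurePreserving_add_right volume s
  set h : E3 → ℝ := fun s => ∫ x, inner ℝ (f (x + s)) (g x) with hh
  have h_eq : h = fun s => inner ℝ (Lp.compMeasurePreserving (T s) (hTm s) (hf.toLp f))
      (hg.toLp g) := by
    ext s
    rw [L2.inner_def]
    refine integral_congr_ae ?_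
    filter_upwards [Lp.coeFn_compMeasurePreserving (hf.toLp f) (hTm s), hg.coeFn_toLp,
      (hTm s).quasiMeasurePreserving.ae hf.coeFn_toLp] with x h1 h2 h3
    rw [h1, h2, Function.comp_apply, h3]
    rfl
  have h_cont : Continuous h := by
    rw [h_eq]
    exact (continuous_const.compMeasurePreservingLp hT hTm (by simp)).inner continuous_const
  have main := ContDiffBump.convolution_tendsto_right_of_continuous (μ := (volume : Measure E3))
    hφ h_cont 0
  have h0 : h 0 = ∫ x, inner ℝ (f x) (g x) := by simp [hh]
  rw [h0] at main
  refine main.congr fun i => ?_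
  set ρ := (φ i).normed (volume : Measure E3) with hρ
  have hρi : Integrable ρ := (φ i).integrable_normed
  have hρc : Continuous ρ := (φ i).continuous_normed
  have hρs : HasCompactSupport ρ := (φ i).hasCompactSupport_normed
  have hρ0 : ∀ t, 0 ≤ ρ t := (φ i).nonneg_normed
  have hint : Integrable (Function.uncurry fun x t => ρ t * inner ℝ (f (x - t)) (g x))
      ((volume : Measure E3).prod volume) := by
    -- the integrand is dominated by `ρ(t) (|f(x - t)|² + |g(x)|²)`
    have hf2 : Integrable fun x => ‖f x‖ ^ 2 := hf.integrable_norm_pow (by norm_num)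
    have hg2 : Integrable fun x => ‖g x‖ ^ 2 := hg.integrable_norm_pow (by norm_num)
    have i1 := hρi.convolution_integrand (lsmul ℝ ℝ) hf2
    have i2 := hg2.mul_prod hρi
    refine (i1.add i2).mono' ?_ (Eventually.of_forall fun p => ?_)
    · have m1 := (hρi.convolution_integrand (lsmul ℝ ℝ) hfi).aestronglyMeasurable
      have m2 : AEStronglyMeasurable (fun p : E3 × E3 => g p.1)
          ((volume : Measure E3).prod volume) := hg.1.comp_fst
      refine (m1.inner m2).congr (Eventually.of_forall fun p => ?_)
      simp [Function.uncurry, inner_smul_left]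
    · simp only [Function.uncurry, norm_mul, Pi.add_apply, lsmul_apply, smul_eq_mul]
      rw [Real.norm_of_nonneg (hρ0 _)]
      have := norm_inner_le_norm (𝕜 := ℝ) (f (p.1 - p.2)) (g p.1)
      nlinarith [hρ0 p.2, sq_nonneg (‖f (p.1 - p.2)‖ - ‖g p.1‖),
        mul_le_mul_of_nonneg_left this (hρ0 p.2),
        mul_nonneg (hρ0 p.2) (sq_nonneg (‖f (p.1 - p.2)‖ - ‖g p.1‖)),
        mul_nonneg (hρ0 p.2) (add_nonneg (sq_nonneg ‖f (p.1 - p.2)‖) (sq_nonneg ‖g p.1‖))]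
  have e1 : ∀ x, inner ℝ (convolution ρ f (lsmul ℝ ℝ) volume x) (g x)
      = ∫ t, ρ t * inner ℝ (f (x - t)) (g x) := by
    intro x
    have hex : Integrable fun t => ρ t • f (x - t) :=
      hρs.convolutionExists_left (lsmul ℝ ℝ) hρc hfi.locallyIntegrable x
    rw [convolution_def, real_inner_comm]
    simp only [lsmul_apply]
    rw [← integral_inner hex]
    refine integral_congr_ae (Eventually.of_forall fun t => ?_)
    simp only [inner_smul_right]
    rw [real_inner_comm]
  simp only [e1]
  rw [integral_integral_swap hint, convolution_def]
  refine integral_congr_ae (Eventually.of_forall fun t => ?_)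
  simp only [lsmul_apply, smul_eq_mul, hh, ← integral_const_mul, zero_sub, ← sub_eq_add_neg]

variable {Ω : Set E3}

/-- The mollification `ρ ⋆ f` of the extension of `f` from `Ω` by zero. -/
noncomputable def mollify {F : Type*} [NormedAddCommGroup F] [NormedSpace ℝ F] (Ω : Set E3)
    (ρ : E3 → ℝ) (f : E3 → F) : E3 → F :=
  convolution ρ (Ω.indicator f) (lsmul ℝ ℝ) volume

theorem mollify_apply {F : Type*} [NormedAddCommGroup F] [NormedSpace ℝ F]
    (hΩ : MeasurableSet Ω) (ρ : E3 → ℝ) (f : E3 → F) (x : E3) :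
    mollify Ω ρ f x = ∫ t in Ω, ρ (x - t) • f t := by
  rw [mollify, convolution_lsmul_swap, ← integral_indicator hΩ]
  congr 1; ext t
  by_cases ht : t ∈ Ω <;> simp [ht]

theorem tendsto_integral_inner_mollify {F : Type*} [NormedAddCommGroup F]
    [InnerProductSpace ℝ F] [CompleteSpace F] [IsFiniteMeasure (volume.restrict Ω)]
    (hΩ : MeasurableSet Ω) {f g : E3 → F} (hf : MemLp f 2 (volume.restrict Ω))
    (hg : MemLp g 2 (volume.restrict Ω)) {φ : ℕ → ContDiffBump (0 : E3)}
    (hφ : Tendsto (fun i => (φ i).rOut) atTop (𝓝 0)) :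
    Tendsto (fun i => ∫ x in Ω, inner ℝ (mollify Ω ((φ i).normed volume) f x) (g x))
      atTop (𝓝 (∫ x in Ω, inner ℝ (f x) (g x))) := by
  have hf' : MemLp (Ω.indicator f) 2 := (memLp_indicator_iff_restrict hΩ).2 hf
  have hg' : MemLp (Ω.indicator g) 2 := (memLp_indicator_iff_restrict hΩ).2 hg
  have hfi : Integrable (Ω.indicator f) :=
    (integrable_indicator_iff hΩ).2 (hf.integrable (by norm_num))
  have main := tendsto_integral_inner_convolution hf' hg' hfi hφ
  have e : ∀ k : E3 → F, ∫ x in Ω, inner ℝ (k x) (g x)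
      = ∫ x, inner ℝ (k x) (Ω.indicator g x) := by
    intro k
    rw [← integral_indicator hΩ]
    congr 1; ext x
    by_cases hx : x ∈ Ω <;> simp [hx]
  have e' : ∫ x in Ω, inner ℝ (f x) (g x)
      = ∫ x, inner ℝ (Ω.indicator f x) (Ω.indicator g x) := by
    rw [← integral_indicator hΩ]
    congr 1; ext x
    by_cases hx : x ∈ Ω <;> simp [hx]
  simp only [e']
  simp only [e]
  exact main

theorem contDiff_mollify {F : Type*} [NormedAddCommGroup F] [NormedSpace ℝ F]
    (hΩ : MeasurableSet Ω) {ρ : E3 → ℝ} (hρ : ContDiff ℝ ∞ ρ) (hc : HasCompactSupport ρ)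
    {f : E3 → F} (hf : IntegrableOn f Ω) : ContDiff ℝ ∞ (mollify Ω ρ f) :=
  hc.contDiff_convolution_left (n := ⊤) (lsmul ℝ ℝ) hρ
    ((integrable_indicator_iff hΩ).2 hf).locallyIntegrable

theorem hasCompactSupport_mollify {F : Type*} [NormedAddCommGroup F] [NormedSpace ℝ F]
    (hΩ : Bornology.IsBounded Ω) {ρ : E3 → ℝ} (hc : HasCompactSupport ρ) (f : E3 → F) :
    HasCompactSupport (mollify Ω ρ f) := by
  refine hc.convolution (lsmul ℝ ℝ) ?_
  exact HasCompactSupport.intro hΩ.isCompact_closure fun x hx =>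
    Set.indicator_of_notMem (fun h => hx (subset_closure h)) f

theorem fderiv_mollify (hΩ : MeasurableSet Ω) {ρ : E3 → ℝ} (hρ : ContDiff ℝ ∞ ρ)
    (hc : HasCompactSupport ρ) {f : E3 → E3} (hf : IntegrableOn f Ω) (x : E3) :
    fderiv ℝ (mollify Ω ρ f) x = ∫ t in Ω, (fderiv ℝ ρ (x - t)).smulRight (f t) := by
  have h := (hc.hasFDerivAt_convolution_left (lsmul ℝ ℝ) (hρ.of_le (by simp))
    ((integrable_indicator_iff hΩ).2 hf).locallyIntegrable x).fderiv
  rw [mollify, h, convolution_def, ← integral_sub_left_eq_self _ _ x, ← integral_indicator hΩ]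
  congr 1; ext t a i
  by_cases ht : t ∈ Ω <;> simp [ht]

theorem integrable_fderiv_smulRight {ρ : E3 → ℝ} (hρ : ContDiff ℝ ∞ ρ)
    (hc : HasCompactSupport ρ) {f : E3 → E3} (hf : IntegrableOn f Ω) (x : E3) :
    IntegrableOn (fun t => (fderiv ℝ ρ (x - t)).smulRight (f t)) Ω := by
  have h1 : Continuous (fderiv ℝ ρ) := hρ.continuous_fderiv (by simp)
  obtain ⟨M, hM⟩ := (hc.fderiv ℝ).exists_bound_of_continuous h1
  exact integrable_bilin (smulRightL ℝ E3 E3) hf (h1.comp (continuous_const.sub continuous_id))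
    (fun t => hM (x - t))

theorem divOf_smulRight (l : E3 →L[ℝ] ℝ) (b : E3) : divOf (l.smulRight b) = l b := by
  have hb : b = ∑ i, b i • EuclideanSpace.single i (1 : ℝ) := by
    ext j; simp [Finset.sum_apply, Pi.single_apply]
  conv_rhs => rw [hb]
  rw [divOf_apply, map_sum, Fin.sum_univ_three]
  simp [mul_comm]

/-- `curl` maps `l ⊗ b` to `l × b`, and the triple product is alternating. -/
theorem inner_curlOf_smulRight (l : E3 →L[ℝ] ℝ) (a b : E3) :
    inner ℝ (curlOf (l.smulRight b)) a = - inner ℝ b (curlOf (l.smulRight a)) := by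
  simp [curlOf, PiLp.inner_apply, Fin.sum_univ_three]
  ring

theorem hasCompactSupport_reflect {ρ : E3 → ℝ} (hc : HasCompactSupport ρ) (x : E3) :
    HasCompactSupport fun t => ρ (x - t) :=
  hc.comp_homeomorph (Homeomorph.subLeft x)

theorem hasFDerivAt_reflect {ρ : E3 → ℝ} (hρ : ContDiff ℝ ∞ ρ) (x t : E3) :
    HasFDerivAt (fun t => ρ (x - t)) (- fderiv ℝ ρ (x - t)) t := by
  have h := ((hρ.differentiable (by simp)) (x - t)).hasFDerivAt.comp t
    ((hasFDerivAt_id t).const_sub x)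
  have e : fderiv ℝ ρ (x - t) ∘L (-ContinuousLinearMap.id ℝ E3) = - fderiv ℝ ρ (x - t) := by
    ext a; simp
  exact e ▸ h

variable [IsFiniteMeasure (volume.restrict Ω)]

/-- Mollification commutes with the divergence of a field without normal trace. -/
theorem divOf_fderiv_mollify (hΩ : MeasurableSet Ω) {ρ : E3 → ℝ} (hρ : ContDiff ℝ ∞ ρ)
    (hc : HasCompactSupport ρ) {v : L2Field Ω} {d : L2Scalar Ω} (h : GreenDiv Ω Set.univ v d)
    (x : E3) : divOf (fderiv ℝ (mollify Ω ρ v) x) = mollify Ω ρ d x := by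
  rw [fderiv_mollify hΩ hρ hc (integrable_L2 v), mollify_apply hΩ,
    ← divOf.integral_comp_comm (integrable_fderiv_smulRight hρ hc (integrable_L2 v) x)]
  have hφ : ContDiff ℝ ∞ fun t => ρ (x - t) := hρ.comp (contDiff_const.sub contDiff_id)
  have e := h _ hφ (hasCompactSupport_reflect hc x) (Set.subset_univ _)
  simp only [smul_eq_mul, mul_comm (ρ _), e, (hasFDerivAt_reflect hρ x _).fderiv, divOf_smulRight,
    neg_apply, integral_neg, neg_neg]

/-- Mollification commutes with the curl of a field without tangential trace. -/
theorem curl_mollify (hΩ : MeasurableSet Ω) {ρ : E3 → ℝ} (hρ : ContDiff ℝ ∞ ρ)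
    (hc : HasCompactSupport ρ) {v w : L2Field Ω} (h : GreenCurl Ω Set.univ v w)
    (x : E3) : curl (mollify Ω ρ v) x = mollify Ω ρ w x := by
  have hi := integrable_fderiv_smulRight hρ hc (integrable_L2 v) x
  refine ext_inner_right ℝ fun a => ?_
  have hφ : ContDiff ℝ ∞ fun t => ρ (x - t) := hρ.comp (contDiff_const.sub contDiff_id)
  have e := h (fun t => ρ (x - t) • a) (hφ.smul contDiff_const)
    (hasCompactSupport_reflect hc x).smul_right (Set.subset_univ _)
  have hcurl : ∀ t, curl (fun t => ρ (x - t) • a) t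
      = - curlOf ((fderiv ℝ ρ (x - t)).smulRight a) := by
    intro t
    rw [curl_eq_curlOf, ((hasFDerivAt_reflect hρ x t).smul_const a).fderiv, ← map_neg]
    congr 1; ext; simp
  have hw : Integrable (fun t => ρ (x - t) • w t) (volume.restrict Ω) := by
    obtain ⟨M, hM⟩ := hc.exists_bound_of_continuous hρ.continuous
    exact integrable_bilin (lsmul ℝ ℝ) (integrable_L2 w) hφ.continuous (fun t => hM (x - t))
  rw [curl_eq_curlOf, fderiv_mollify hΩ hρ hc (integrable_L2 v), mollify_apply hΩ,
    ← curlOf.integral_comp_comm hi, real_inner_comm, real_inner_comm a,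
    ← integral_inner (curlOf.integrable_comp hi), ← integral_inner hw]
  simp only [inner_smul_right, hcurl, inner_neg_right] at e ⊢
  simp only [real_inner_comm _ a, inner_curlOf_smulRight]
  exact e.symm

end Mollify

/-! ### The Friedrichs inequality -/

section Friedrichs

open Filter Topology ContinuousLinearMap

/-- The cross product of Euclidean three-space, as a continuous bilinear map. -/
noncomputable def cross : E3 →L[ℝ] E3 →L[ℝ] E3 :=
  LinearMap.mkContinuous₂
    (LinearMap.mk₂ ℝ
      (fun a b : E3 => (!₂[a 1 * b 2 - a 2 * b 1, a 2 * b 0 - a 0 * b 2,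
        a 0 * b 1 - a 1 * b 0] : E3))
      (fun a a' b => by ext i; fin_cases i <;> simp <;> ring)
      (fun c a b => by ext i; fin_cases i <;> simp <;> ring)
      (fun a b b' => by ext i; fin_cases i <;> simp <;> ring)
      (fun c a b => by ext i; fin_cases i <;> simp <;> ring))
    1 (fun a b => by
      rw [one_mul, ← sq_le_sq₀ (norm_nonneg _) (by positivity), mul_pow,
        EuclideanSpace.real_norm_sq_eq, EuclideanSpace.real_norm_sq_eq,
        EuclideanSpace.real_norm_sq_eq]
      simp only [LinearMap.mk₂_apply, Fin.sum_univ_three]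
      simp
      -- Lagrange's identity
      nlinarith [sq_nonneg (a 0 * b 0 + a 1 * b 1 + a 2 * b 2)])

theorem cross_apply (a b : E3) : cross a b = !₂[a 1 * b 2 - a 2 * b 1, a 2 * b 0 - a 0 * b 2,
    a 0 * b 1 - a 1 * b 0] := rfl

theorem norm_cross_le (a b : E3) : ‖cross a b‖ ≤ ‖a‖ * ‖b‖ := by
  have h : ‖cross‖ ≤ 1 := LinearMap.mkContinuous₂_norm_le _ zero_le_one _
  calc ‖cross a b‖ ≤ ‖cross‖ * ‖a‖ * ‖b‖ := le_opNorm₂ _ _ _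
    _ ≤ 1 * ‖a‖ * ‖b‖ := by gcongr
    _ = _ := by ring

theorem inner_cross_rotate (a b c : E3) : inner ℝ a (cross b c) = inner ℝ c (cross a b) := by
  simp [cross_apply, PiLp.inner_apply, Fin.sum_univ_three]
  ring

/-- The pointwise identity behind the Friedrichs inequality: with `x` the position vector,
`v · ∇(x · u)` and `v · curl (x × u)` add up to
`(div u) (x · v) - curl u · (x × v) - u · v`. -/
theorem inner_eq_position_identity {u : E3 → E3} {x : E3} (hu : DifferentiableAt ℝ u x) (v : E3) :
    inner ℝ (u x) v = - fderiv ℝ (fun y => inner ℝ y (u y)) x v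
      - inner ℝ v (curl (fun y => cross y (u y)) x)
      + divOf (fderiv ℝ u x) * inner ℝ x v - inner ℝ (curl u x) (cross x v) := by
  have h := hu.hasFDerivAt
  set T := fderiv ℝ u x with hT
  have h1 : fderiv ℝ (fun y => inner ℝ y (u y)) x v = inner ℝ x (T v) + inner ℝ v (u x) := by
    have e := ((hasFDerivAt_id x).inner ℝ h).fderiv
    simp only [id] at e
    rw [e]
    simp
  have h2 : ∀ a, fderiv ℝ (fun y => cross y (u y)) x a = cross x (T a) + cross a (u x) := by
    intro a
    have e := (cross.hasFDerivAt_of_bilinear (hasFDerivAt_id x) h).fderiv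
    simp only [id] at e
    rw [e]
    simp
  have hv : v = ∑ i, v i • EuclideanSpace.single i (1 : ℝ) := by
    ext j; simp [Finset.sum_apply, Pi.single_apply]
  have h3 : T v = v 0 • T (EuclideanSpace.single 0 1) + v 1 • T (EuclideanSpace.single 1 1)
      + v 2 • T (EuclideanSpace.single 2 1) := by
    conv_lhs => rw [hv]
    rw [Fin.sum_univ_three, map_add, map_add, map_smul, map_smul, map_smul]
  rw [h1, h3, curl_eq_curlOf, curl_eq_curlOf, ← hT, divOf_apply]
  generalize fderiv ℝ (fun y => cross y (u y)) x = S at h2 ⊢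
  simp [curlOf, h2, cross_apply, PiLp.inner_apply, Fin.sum_univ_three]
  ring

variable {Ω : Set E3}

theorem memLp_bilin_position {F H : Type*} [NormedAddCommGroup F] [NormedSpace ℝ F]
    [NormedAddCommGroup H] [NormedSpace ℝ H] (hΩ : MeasurableSet Ω) {R : ℝ}
    (hR : ∀ x ∈ Ω, ‖x‖ ≤ R) (B : E3 →L[ℝ] F →L[ℝ] H) (hB : ∀ a b, ‖B a b‖ ≤ ‖a‖ * ‖b‖)
    (f : Lp F 2 (volume.restrict Ω)) :
    MemLp (fun x => B x (f x)) 2 (volume.restrict Ω) := by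
  refine (Lp.memLp f).of_le_mul (c := R) ?_ ?_
  · exact B.isBoundedBilinearMap.continuous.comp_aestronglyMeasurable
      (continuous_id.aestronglyMeasurable.prodMk (Lp.memLp f).1)
  · filter_upwards [ae_restrict_mem hΩ] with x hx
    exact (hB _ _).trans (by gcongr; exact hR x hx)

/-- On a bounded domain, multiplication by the position vector is bounded in `L²`. -/
theorem abs_integral_inner_bilin_position_le {F H : Type*} [NormedAddCommGroup F] [NormedSpace ℝ F]
    [NormedAddCommGroup H] [InnerProductSpace ℝ H] (hΩ : MeasurableSet Ω) {R : ℝ}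
    (hR : ∀ x ∈ Ω, ‖x‖ ≤ R) (B : E3 →L[ℝ] F →L[ℝ] H) (hB : ∀ a b, ‖B a b‖ ≤ ‖a‖ * ‖b‖)
    (g : Lp H 2 (volume.restrict Ω)) (f : Lp F 2 (volume.restrict Ω)) :
    |∫ x in Ω, inner ℝ (g x) (B x (f x))| ≤ R * ‖g‖ * ‖f‖ := by
  have hm := memLp_bilin_position hΩ hR B hB f
  have e : ∫ x in Ω, inner ℝ (g x) (B x (f x)) = inner ℝ g (hm.toLp _) := by
    rw [L2.inner_def]
    refine integral_congr_ae ?_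
    filter_upwards [hm.coeFn_toLp] with x hx
    rw [hx]
  have hn : ‖hm.toLp _‖ ≤ R * ‖f‖ := by
    refine Lp.norm_le_mul_norm_of_ae_le_mul ?_
    filter_upwards [hm.coeFn_toLp, ae_restrict_mem hΩ] with x hx hxΩ
    rw [hx]
    exact (hB _ _).trans (by gcongr; exact hR x hxΩ)
  rw [e]
  calc _ ≤ ‖g‖ * ‖hm.toLp _‖ := abs_real_inner_le_norm _ _
    _ ≤ ‖g‖ * (R * ‖f‖) := by gcongr
    _ = _ := by ring

theorem norm_innerSL_apply_le (a b : E3) : ‖innerSL ℝ a b‖ ≤ ‖a‖ * ‖b‖ := by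
  simpa using norm_inner_le_norm (𝕜 := ℝ) a b

theorem norm_lsmul_flip_apply_le (a : E3) (b : ℝ) :
    ‖(lsmul ℝ ℝ : ℝ →L[ℝ] E3 →L[ℝ] E3).flip a b‖ ≤ ‖a‖ * ‖b‖ := by
  simp [norm_smul, mul_comm]

theorem norm_cross_flip_le (a b : E3) : ‖cross.flip a b‖ ≤ ‖a‖ * ‖b‖ := by
  rw [flip_apply, mul_comm]
  exact norm_cross_le b a

variable [IsFiniteMeasure (volume.restrict Ω)]

/-- The product rule `inner_eq_position_identity`, integrated against a field without boundary
traces. The derivatives of that field enter through Green's formula with the test functions `x · u`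
and `x × u`, which is why the formula is needed on the whole space. -/
theorem integral_inner_test_eq (hΩ : MeasurableSet Ω) {R : ℝ} (hR : ∀ x ∈ Ω, ‖x‖ ≤ R)
    {v w : L2Field Ω} {d : L2Scalar Ω}
    (hd : GreenDiv Ω Set.univ v d) (hw : GreenCurl Ω Set.univ v w) {u : E3 → E3}
    (hu : ContDiff ℝ ∞ u) (hc : HasCompactSupport u) :
    ∫ x in Ω, inner ℝ (u x) (v x) =
      (∫ x in Ω, inner ℝ (u x) ((lsmul ℝ ℝ : ℝ →L[ℝ] E3 →L[ℝ] E3).flip x (d x)))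
      - (∫ x in Ω, inner ℝ (u x) (cross.flip x (w x)))
      + (∫ x in Ω, inner ℝ (divOf (fderiv ℝ u x)) (innerSL ℝ x (v x)))
      - ∫ x in Ω, inner ℝ (curl u x) (cross x (v x)) := by
  have hφ : ContDiff ℝ ∞ fun y => inner ℝ y (u y) := contDiff_id.inner ℝ hu
  have hφc : HasCompactSupport fun y => inner ℝ y (u y) :=
    hc.mono fun x hx => by
      simp only [Function.mem_support] at hx ⊢
      contrapose! hx
      simp [hx]
  have hψ : ContDiff ℝ ∞ fun y => cross y (u y) := cross.contDiff.clm_apply hu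
  have hψc : HasCompactSupport fun y => cross y (u y) :=
    hc.mono fun x hx => by
      simp only [Function.mem_support] at hx ⊢
      contrapose! hx
      simp [hx]
  have e1 : ∫ x in Ω, inner ℝ (u x) ((lsmul ℝ ℝ : ℝ →L[ℝ] E3 →L[ℝ] E3).flip x (d x))
      = - ∫ x in Ω, fderiv ℝ (fun y => inner ℝ y (u y)) x (v x) := by
    rw [← hd _ hφ hφc (Set.subset_univ _)]
    congr 1; ext x
    simp [inner_smul_right, real_inner_comm]
  have e2 : ∫ x in Ω, inner ℝ (u x) (cross.flip x (w x))
      = ∫ x in Ω, inner ℝ (v x) (curl (fun y => cross y (u y)) x) := by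
    rw [← hw _ hψ hψc (Set.subset_univ _)]
    congr 1; ext x
    rw [flip_apply, inner_cross_rotate (w x)]
  have i1 := integrable_fderiv_test v hφ hφc
  have i2 := integrable_inner_test v (continuous_curl hψ) (hasCompactSupport_curl hψc)
  have hm2 := memLp_bilin_position hΩ hR (innerSL ℝ) norm_innerSL_apply_le v
  have hm3 := memLp_bilin_position hΩ hR cross norm_cross_le v
  have hu' : Continuous (fderiv ℝ u) := hu.continuous_fderiv (by simp)
  have i3 : Integrable (fun x => inner ℝ (divOf (fderiv ℝ u x)) (innerSL ℝ x (v x)))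
      (volume.restrict Ω) := by
    obtain ⟨M, hM⟩ := ((hc.fderiv ℝ).comp_left (map_zero divOf)).exists_bound_of_continuous
      (divOf.continuous.comp hu')
    exact integrable_bilin (innerSL ℝ) (hm2.integrable (by norm_num))
      (divOf.continuous.comp hu') hM
  have i4 : Integrable (fun x => inner ℝ (curl u x) (cross x (v x))) (volume.restrict Ω) := by
    obtain ⟨M, hM⟩ := (hasCompactSupport_curl hc).exists_bound_of_continuous (continuous_curl hu)
    exact integrable_bilin (innerSL ℝ) (hm3.integrable (by norm_num)) (continuous_curl hu) hM
  have s1 := integral_sub ((i1.neg.sub i2).add i3) i4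
  have s2 := integral_add (i1.neg.sub i2) i3
  have s3 := integral_sub i1.neg i2
  simp only [Pi.add_apply, Pi.sub_apply, Pi.neg_apply, integral_neg] at s1 s2 s3
  rw [e1, e2, ← s3, ← s2, ← s1]
  congr 1; ext x
  rw [inner_eq_position_identity (hu.differentiable (by simp) x) (v x)]
  simp [mul_comm]

/-- The identity `‖v‖² = 2 ∫ ((x · v) div v - (x × v) · curl v)` for fields without boundary
traces, with each of the two terms on the right written twice. Mollifications of `v` are inserted in
`integral_inner_test_eq`; as that identity is bilinear, weak convergence is enough for the limit. -/
theorem integral_inner_self_eq (hΩb : Bornology.IsBounded Ω) (hΩ : MeasurableSet Ω) {R : ℝ}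
    (hR : ∀ x ∈ Ω, ‖x‖ ≤ R) {v w : L2Field Ω} {d : L2Scalar Ω}
    (hd : GreenDiv Ω Set.univ v d) (hw : GreenCurl Ω Set.univ v w) :
    ∫ x in Ω, inner ℝ (v x) (v x) =
      (∫ x in Ω, inner ℝ (v x) ((lsmul ℝ ℝ : ℝ →L[ℝ] E3 →L[ℝ] E3).flip x (d x)))
      - (∫ x in Ω, inner ℝ (v x) (cross.flip x (w x)))
      + (∫ x in Ω, inner ℝ (d x) (innerSL ℝ x (v x)))
      - ∫ x in Ω, inner ℝ (w x) (cross x (v x)) := by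
  let φ : ℕ → ContDiffBump (0 : E3) := fun n =>
    ⟨1 / (n + 2), 1 / (n + 1), by positivity, by gcongr; norm_num⟩
  have hφ : Tendsto (fun i => (φ i).rOut) atTop (𝓝 0) := tendsto_one_div_add_atTop_nhds_zero_nat
  have lim {F : Type} [NormedAddCommGroup F] [InnerProductSpace ℝ F] [CompleteSpace F]
      (f : Lp F 2 (volume.restrict Ω)) {g : E3 → F} (hg : MemLp g 2 (volume.restrict Ω)) :=
    tendsto_integral_inner_mollify hΩ (Lp.memLp f) hg hφ
  have m1 := memLp_bilin_position hΩ hR _ norm_lsmul_flip_apply_le d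
  have m2 := memLp_bilin_position hΩ hR _ norm_cross_flip_le w
  have m3 := memLp_bilin_position hΩ hR _ norm_innerSL_apply_le v
  have m4 := memLp_bilin_position hΩ hR _ norm_cross_le v
  refine tendsto_nhds_unique (lim v (Lp.memLp v))
    (((((lim v m1).sub (lim v m2)).add (lim d m3)).sub (lim w m4)).congr fun i => ?_)
  have hρ : ContDiff ℝ ∞ ((φ i).normed (volume : Measure E3)) := (φ i).contDiff_normed
  have hρc : HasCompactSupport ((φ i).normed (volume : Measure E3)) :=
    (φ i).hasCompactSupport_normed
  rw [integral_inner_test_eq hΩ hR hd hw (contDiff_mollify hΩ hρ hρc (integrable_L2 v))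
    (hasCompactSupport_mollify hΩb hρc v)]
  simp only [divOf_fderiv_mollify hΩ hρ hρc hd, curl_mollify hΩ hρ hρc hw]

/-- The Friedrichs inequality, with the constant `8 R²` for a domain in the ball of radius `R` about
the origin. Vanishing of both traces makes any regularity of the boundary superfluous. -/
theorem exists_isFriedrichsConst (hΩb : Bornology.IsBounded Ω) (hΩ : MeasurableSet Ω) :
    ∃ C, IsFriedrichsConst Ω (HDC0 Ω) C := by
  obtain ⟨R, hR0, hR⟩ := hΩb.exists_pos_norm_le
  refine ⟨8 * R ^ 2, by positivity, fun v hv => ?_⟩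
  obtain ⟨-, hd, hw⟩ := hv
  set d := weakDiv Ω v
  set w := weakCurl Ω v
  have e := integral_inner_self_eq hΩb hΩ hR hd hw
  rw [← L2.inner_def, real_inner_self_eq_norm_sq] at e
  have b1 := abs_le.1 (abs_integral_inner_bilin_position_le hΩ hR _ norm_lsmul_flip_apply_le v d)
  have b2 := abs_le.1 (abs_integral_inner_bilin_position_le hΩ hR _ norm_cross_flip_le v w)
  have b3 := abs_le.1 (abs_integral_inner_bilin_position_le hΩ hR _ norm_innerSL_apply_le d v)
  have b4 := abs_le.1 (abs_integral_inner_bilin_position_le hΩ hR _ norm_cross_le w v)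
  have h1 : ‖v‖ * ‖v‖ ≤ ‖v‖ * (2 * R * (‖d‖ + ‖w‖)) := by linarith [b1.2, b2.1, b3.2, b4.1]
  have h2 : ‖v‖ ≤ 2 * R * (‖d‖ + ‖w‖) := by
    rcases (norm_nonneg v).eq_or_lt with h | h
    · rw [← h]; positivity
    · exact le_of_mul_le_mul_left h1 h
  calc ‖v‖ ^ 2 ≤ (2 * R * (‖d‖ + ‖w‖)) ^ 2 := by gcongr
    _ ≤ 8 * R ^ 2 * (‖d‖ ^ 2 + ‖w‖ ^ 2) := by
      nlinarith [mul_nonneg (sq_nonneg R) (sq_nonneg (‖d‖ - ‖w‖))]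

end Friedrichs

/-! ### Coercive problems on a finite-dimensional space -/

theorem exists_bound_bilin {E : Type*} [NormedAddCommGroup E] [NormedSpace ℝ E]
    [FiniteDimensional ℝ E] (A : E →ₗ[ℝ] E →ₗ[ℝ] ℝ) :
    ∃ M : ℝ, 0 ≤ M ∧ ∀ u v, |A u v| ≤ M * ‖u‖ * ‖v‖ :=
  ⟨‖A.toContinuousBilinearMap‖, ContinuousLinearMap.opNorm_nonneg _,
    A.toContinuousBilinearMap.le_opNorm₂⟩

section LaxMilgram

variable {Ω : Set E3}

theorem hdcNorm_nonneg (v : L2Field Ω) : 0 ≤ hdcNorm Ω v := Real.sqrt_nonneg _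

theorem hdcNorm_sq (v : L2Field Ω) :
    hdcNorm Ω v ^ 2 = ‖v‖ ^ 2 + ‖weakDiv Ω v‖ ^ 2 + ‖weakCurl Ω v‖ ^ 2 :=
  Real.sq_sqrt (by positivity)

theorem norm_le_hdcNorm (v : L2Field Ω) : ‖v‖ ≤ hdcNorm Ω v :=
  Real.le_sqrt_of_sq_le (by nlinarith [sq_nonneg ‖weakDiv Ω v‖, sq_nonneg ‖weakCurl Ω v‖])

theorem norm_weakCurl_le_hdcNorm (v : L2Field Ω) : ‖weakCurl Ω v‖ ≤ hdcNorm Ω v :=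
  Real.le_sqrt_of_sq_le (by nlinarith [sq_nonneg ‖weakDiv Ω v‖, sq_nonneg ‖v‖])

/-- The Lax–Milgram theorem in finite dimension: linear maps are bounded there, and a coercive form
is nondegenerate, so that only bilinearity and coercivity have to be known. -/
theorem isWellPosed_of_coercive {V : Submodule ℝ (L2Field Ω)} [FiniteDimensional ℝ V]
    {a : L2Field Ω → L2Field Ω → ℝ} {F : L2Field Ω → ℝ}
    (hA : ∃ A : V →ₗ[ℝ] V →ₗ[ℝ] ℝ, ∀ u v : V, A u v = a u v)
    (hF : ∃ f : V →ₗ[ℝ] ℝ, ∀ v : V, f v = F v)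
    {c : ℝ} (hc : IsCoercivityConst Ω V a c) : IsWellPosed Ω V a F := by
  obtain ⟨A, hA'⟩ := hA
  obtain ⟨f, hf⟩ := hF
  have hinj : Function.Injective A := by
    rw [← LinearMap.ker_eq_bot, LinearMap.ker_eq_bot']
    intro u hu
    have h1 := hc.2 u u.2
    rw [← hA', hu, LinearMap.zero_apply] at h1
    have h2 : hdcNorm Ω (u : L2Field Ω) ^ 2 ≤ 0 := by
      by_contra! h
      exact absurd h1 (not_le.2 (mul_pos hc.1 h))
    have h3 := pow_eq_zero_iff (two_ne_zero) |>.1 (le_antisymm h2 (sq_nonneg _))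
    have h4 : ‖(u : L2Field Ω)‖ ≤ 0 := h3 ▸ norm_le_hdcNorm (u : L2Field Ω)
    exact Subtype.ext (norm_le_zero_iff.1 h4)
  have hsurj : Function.Surjective A :=
    (LinearMap.injective_iff_surjective_of_finrank_eq_finrank
      (Subspace.dual_finrank_eq (K := ℝ) (V := V)).symm).1 hinj
  have hsol (G : V →ₗ[ℝ] ℝ) : ∃! u : V, ∀ v : V, a u v = G v := by
    obtain ⟨u, hu⟩ := hsurj G
    refine ⟨u, fun v => by rw [← hA', hu], fun u' hu' => hinj ?_⟩
    rw [hu]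
    ext v
    rw [hA', hu']
  refine ⟨⟨f, hf⟩, ?_, ⟨A, hA'⟩, ?_, ⟨c, hc⟩, ?_, ?_⟩
  · refine ⟨‖f.toContinuousLinearMap‖, fun v hv => ?_⟩
    rw [← hf ⟨v, hv⟩]
    refine (f.toContinuousLinearMap.le_opNorm ⟨v, hv⟩).trans ?_
    gcongr
    exact norm_le_hdcNorm v
  · obtain ⟨M, hM0, hM⟩ := exists_bound_bilin A
    refine ⟨M, fun u hu v hv => ?_⟩
    rw [← hA' ⟨u, hu⟩ ⟨v, hv⟩]
    refine (hM ⟨u, hu⟩ ⟨v, hv⟩).trans ?_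
    have := hdcNorm_nonneg u
    gcongr
    exacts [norm_le_hdcNorm u, norm_le_hdcNorm v]
  · simpa only [hf] using hsol f
  · refine ⟨1 / c, fun G M hM hG => ?_⟩
    obtain ⟨u, hu, huniq⟩ := hsol G
    refine ⟨u, ⟨hu, ?_⟩, fun u' hu' => huniq u' hu'.1⟩
    have h1 := hc.2 u u.2
    rw [hu u] at h1
    have h2 := (h1.trans (le_abs_self _)).trans (hG u)
    have h0 := hdcNorm_nonneg (u : L2Field Ω)
    rw [one_div, inv_mul_eq_div, le_div_iff₀ hc.1]
    rcases h0.eq_or_lt with h | h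
    · rw [← h, zero_mul]; exact hM
    · exact le_of_mul_le_mul_right (by linarith [h2]) h

theorem ae_norm_le_norm_Linfty {F : Type*} [NormedAddCommGroup F] {μ : Measure E3}
    (f : Lp F ∞ μ) : ∀ᵐ x ∂μ, ‖f x‖ ≤ ‖f‖ := by
  filter_upwards [enorm_ae_le_eLpNormEssSup f μ] with x hx
  rw [Lp.norm_def, eLpNorm_exponent_top, ← toReal_enorm]
  exact ENNReal.toReal_mono (by simpa using (Lp.memLp f).2.ne) hx

/-- Fields of a finite-dimensional space of essentially bounded fields are bounded by a fixed
multiple of their `L²` norm. -/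
theorem exists_ae_norm_le (V : Submodule ℝ (L2Field Ω)) [FiniteDimensional ℝ V]
    (hV : ∀ v ∈ V, MemLp v ∞ (volume.restrict Ω)) :
    ∃ b : ℝ, 0 ≤ b ∧ ∀ v ∈ V, ∀ᵐ x ∂(volume.restrict Ω), ‖v x‖ ≤ b * ‖v‖ := by
  let L : V →ₗ[ℝ] Lp E3 ∞ (volume.restrict Ω) :=
    { toFun := fun v => (hV v v.2).toLp _
      map_add' := fun u v => by
        rw [← MemLp.toLp_add]
        exact (MemLp.toLp_eq_toLp_iff _ _).2 (Lp.coeFn_add _ _)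
      map_smul' := fun c v => by
        rw [RingHom.id_apply, ← MemLp.toLp_const_smul]
        exact (MemLp.toLp_eq_toLp_iff _ _).2 (Lp.coeFn_smul _ _) }
  refine ⟨‖L.toContinuousLinearMap‖, ContinuousLinearMap.opNorm_nonneg _, fun v hv => ?_⟩
  have h1 : ‖L ⟨v, hv⟩‖ ≤ ‖L.toContinuousLinearMap‖ * ‖v‖ :=
    L.toContinuousLinearMap.le_opNorm ⟨v, hv⟩
  filter_upwards [(hV v hv).coeFn_toLp, ae_norm_le_norm_Linfty (L ⟨v, hv⟩)] with x h2 h3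
  rw [← h2]
  exact h3.trans h1

end LaxMilgram

/-! ### The linearized forms as `L²` inner products -/

section Forms

variable {Ω : Set E3}

theorem Zmat_mulVec_dotProduct (κ : ℝ) (n a b : E3) :
    (Zmat κ n *ᵥ a.ofLp) ⬝ᵥ b.ofLp
      = inner ℝ a b + (κ - 1) * (inner ℝ n a * inner ℝ n b) := by
  simp [Zmat, Matrix.add_mulVec, Matrix.sub_mulVec, Matrix.smul_mulVec, Matrix.vecMulVec_mulVec,
    dotProduct, PiLp.inner_apply, Fin.sum_univ_three]
  ring

theorem integral_mul_eq_inner {f g : E3 → ℝ} {F G : L2Scalar Ω}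
    (hf : F =ᵐ[volume.restrict Ω] f) (hg : G =ᵐ[volume.restrict Ω] g) :
    ∫ x in Ω, f x * g x = inner ℝ F G := by
  rw [L2.inner_def]
  refine integral_congr_ae ?_
  filter_upwards [hf, hg] with x h1 h2
  rw [h1, h2, real_inner_eq_re_inner]
  simp [mul_comm]

theorem integral_Zmat_eq_inner (κ : ℝ) {n a b : L2Field Ω} {p q : L2Scalar Ω}
    (hp : p =ᵐ[volume.restrict Ω] fun x => inner ℝ (n x) (a x))
    (hq : q =ᵐ[volume.restrict Ω] fun x => inner ℝ (n x) (b x)) :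
    ∫ x in Ω, (Zmat κ (n x) *ᵥ (a x).ofLp) ⬝ᵥ (b x).ofLp
      = inner ℝ a b + (κ - 1) * inner ℝ p q := by
  rw [L2.inner_def, L2.inner_def, ← integral_const_mul,
    ← integral_add (L2.integrable_inner a b) ((L2.integrable_inner p q).const_mul _)]
  refine integral_congr_ae ?_
  filter_upwards [hp, hq] with x h1 h2
  rw [Zmat_mulVec_dotProduct, h1, h2]
  simp [mul_comm]

/-- Pointwise application of linear maps `A x` to a linear family of `L²` fields. -/
noncomputable def pointwiseMap {V F : Type*} [AddCommGroup V] [Module ℝ V] [NormedAddCommGroup F]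
    [NormedSpace ℝ F] (C : V →ₗ[ℝ] L2Field Ω) (A : E3 → E3 →ₗ[ℝ] F)
    (h : ∀ v, MemLp (fun x => A x (C v x)) 2 (volume.restrict Ω)) :
    V →ₗ[ℝ] Lp F 2 (volume.restrict Ω) where
  toFun v := (h v).toLp _
  map_add' u v := by
    rw [← MemLp.toLp_add, MemLp.toLp_eq_toLp_iff, map_add]
    filter_upwards [Lp.coeFn_add (C u) (C v)] with x hx
    rw [hx, Pi.add_apply, map_add, Pi.add_apply]
  map_smul' c v := by
    rw [RingHom.id_apply, ← MemLp.toLp_const_smul, MemLp.toLp_eq_toLp_iff, map_smul]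
    filter_upwards [Lp.coeFn_smul c (C v)] with x hx
    rw [hx, Pi.smul_apply, map_smul, Pi.smul_apply]

/-- The linear maps `V → L²` in terms of which the linearized forms at `n` are sums of `L²` inner
products. The essential bounds on `n` and on the fields in `V` are what makes them take values in
`L²`. -/
structure IterateMaps (Ω : Set E3) (V : Submodule ℝ (L2Field Ω)) (n : L2Field Ω) where
  /-- the divergence -/
  D : V →ₗ[ℝ] L2Scalar Ω
  /-- the curl -/
  C : V →ₗ[ℝ] L2Field Ω
  /-- `v ↦ n · curl v` -/
  N : V →ₗ[ℝ] L2Scalar Ω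
  /-- `v ↦ n · v` -/
  P : V →ₗ[ℝ] L2Scalar Ω
  /-- `v ↦ curl n · v` -/
  Q : V →ₗ[ℝ] L2Scalar Ω
  /-- `v ↦ (n · curl n) v` -/
  S : V →ₗ[ℝ] L2Field Ω
  /-- `v ↦ (n · n - 1) v` -/
  Y : V →ₗ[ℝ] L2Field Ω
  hD : ∀ v, D v = weakDiv Ω v
  hC : ∀ v, C v = weakCurl Ω v
  hN : ∀ v, N v =ᵐ[volume.restrict Ω] fun x => inner ℝ (n x) (weakCurl Ω v x)
  hP : ∀ v, P v =ᵐ[volume.restrict Ω] fun x => inner ℝ (n x) ((v : L2Field Ω) x)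
  hQ : ∀ v, Q v =ᵐ[volume.restrict Ω] fun x => inner ℝ (weakCurl Ω n x) ((v : L2Field Ω) x)
  hS : ∀ v, S v =ᵐ[volume.restrict Ω] fun x =>
    (inner ℝ (n x) (weakCurl Ω n x) : ℝ) • (v : L2Field Ω) x
  hY : ∀ v, Y v =ᵐ[volume.restrict Ω] fun x =>
    ((inner ℝ (n x) (n x) : ℝ) - 1) • (v : L2Field Ω) x

theorem memLp_inner_of_ae_norm_le {n f : L2Field Ω} {s : ℝ}
    (hn : ∀ᵐ x ∂(volume.restrict Ω), ‖n x‖ ≤ s) :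
    MemLp (fun x => (inner ℝ (n x) (f x) : ℝ)) 2 (volume.restrict Ω) := by
  refine (Lp.memLp f).of_le_mul (c := s) ((Lp.memLp n).1.inner (Lp.memLp f).1) ?_
  filter_upwards [hn] with x hx
  exact (norm_inner_le_norm _ _).trans (by gcongr)

theorem memLp_inner_self_sub_one_smul {n : L2Field Ω} {s : ℝ}
    (hn : ∀ᵐ x ∂(volume.restrict Ω), ‖n x‖ ≤ s) (f : L2Field Ω) :
    MemLp (fun x => ((inner ℝ (n x) (n x) : ℝ) - 1) • f x) 2 (volume.restrict Ω) := by
  have h1 : AEStronglyMeasurable (fun x => (inner ℝ (n x) (n x) : ℝ) - 1) (volume.restrict Ω) :=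
    ((Lp.memLp n).1.inner (Lp.memLp n).1).sub aestronglyMeasurable_const
  refine (Lp.memLp f).of_le_mul (c := s ^ 2 + 1) (h1.smul (Lp.memLp f).1) ?_
  filter_upwards [hn] with x hx
  rw [norm_smul]
  gcongr
  refine (norm_sub_le _ _).trans ?_
  rw [real_inner_self_eq_norm_sq, norm_one, norm_pow, norm_norm]
  gcongr

theorem exists_iterateMaps [IsFiniteMeasure (volume.restrict Ω)] (hΩ : IsOpen Ω)
    {V : Submodule ℝ (L2Field Ω)} (hV : (V : Set (L2Field Ω)) ⊆ HDC Ω)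
    (hVb : ∀ v ∈ V, ∃ M : ℝ, ∀ᵐ x ∂(volume.restrict Ω), ‖v x‖ ≤ M) {n : L2Field Ω} {s : ℝ}
    (hn : ∀ᵐ x ∂(volume.restrict Ω), ‖n x‖ ≤ s) : Nonempty (IterateMaps Ω V n) := by
  have hN : ∀ v : V, MemLp (fun x => innerₗ E3 (n x) (weakCurlₗ hΩ V hV v x)) 2
      (volume.restrict Ω) := fun v => memLp_inner_of_ae_norm_le hn
  have hP : ∀ v : V, MemLp (fun x => innerₗ E3 (n x) (V.subtype v x)) 2
      (volume.restrict Ω) := fun v => memLp_inner_of_ae_norm_le hn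
  have hQ : ∀ v : V, MemLp (fun x => innerₗ E3 (weakCurl Ω n x) (V.subtype v x)) 2
      (volume.restrict Ω) := fun v => by
    obtain ⟨M, hM⟩ := hVb v v.2
    refine (memLp_inner_of_ae_norm_le (f := weakCurl Ω n) hM).ae_eq ?_
    exact Filter.Eventually.of_forall fun x => real_inner_comm _ _
  have hS : ∀ v : V, MemLp (fun x => ((inner ℝ (n x) (weakCurl Ω n x) : ℝ) •
      (LinearMap.id : E3 →ₗ[ℝ] E3)) (V.subtype v x)) 2 (volume.restrict Ω) := fun v => by
    obtain ⟨M, hM⟩ := hVb v v.2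
    have h1 := memLp_inner_of_ae_norm_le (f := weakCurl Ω n) hn
    refine h1.of_le_mul (c := M) (h1.1.smul (Lp.memLp (v : L2Field Ω)).1) ?_
    filter_upwards [hM] with x hx
    simp only [LinearMap.smul_apply, LinearMap.id_apply, norm_smul]
    rw [mul_comm]
    gcongr
    exact hx
  have hY : ∀ v : V, MemLp (fun x => (((inner ℝ (n x) (n x) : ℝ) - 1) •
      (LinearMap.id : E3 →ₗ[ℝ] E3)) (V.subtype v x)) 2 (volume.restrict Ω) := fun v =>
    memLp_inner_self_sub_one_smul hn (v : L2Field Ω)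
  exact ⟨{
    D := weakDivₗ hΩ V hV
    C := weakCurlₗ hΩ V hV
    N := pointwiseMap _ _ hN
    P := pointwiseMap _ _ hP
    Q := pointwiseMap _ _ hQ
    S := pointwiseMap _ _ hS
    Y := pointwiseMap _ _ hY
    hD := fun v => rfl
    hC := fun v => rfl
    hN := fun v => (hN v).coeFn_toLp
    hP := fun v => (hP v).coeFn_toLp
    hQ := fun v => (hQ v).coeFn_toLp
    hS := fun v => (hS v).coeFn_toLp
    hY := fun v => (hY v).coeFn_toLp }⟩

namespace IterateMaps

variable {V : Submodule ℝ (L2Field Ω)} {n : L2Field Ω} (L : IterateMaps Ω V n)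

theorem newtonForm_eq (K₁ K₂ : ℝ) {K₃ : ℝ} (hK₃ : K₃ ≠ 0) (ζ : ℝ) (u v : V) :
    newtonForm Ω K₁ K₂ K₃ ζ n u v =
      K₁ * inner ℝ (L.D u) (L.D v) + K₃ * inner ℝ (L.C u) (L.C v)
      + (K₂ - K₃) * (inner ℝ (L.N u) (L.N v) + inner ℝ (L.S u) (L.C v)
        + inner ℝ (L.N v) (L.Q u) + inner ℝ (L.S v) (L.C u)
        + inner ℝ (L.N u) (L.Q v) + inner ℝ (L.Q u) (L.Q v))
      + 2 * ζ * (inner ℝ (L.Y u) (v : L2Field Ω) + 2 * inner ℝ (L.P u) (L.P v)) := by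
  have hS (u v : V) : inner ℝ (L.S u) (L.C v) = ∫ x in Ω,
      inner ℝ ((u : L2Field Ω) x) (weakCurl Ω v x) * inner ℝ (n x) (weakCurl Ω n x) := by
    rw [L2.inner_def, L.hC]
    refine integral_congr_ae ?_
    filter_upwards [L.hS u] with x hx
    rw [hx, real_inner_smul_left, mul_comm]
  have hS' : inner ℝ (L.S v) (L.C u) = ∫ x in Ω,
      inner ℝ (n x) (weakCurl Ω n x) * inner ℝ ((v : L2Field Ω) x) (weakCurl Ω u x) := by
    rw [hS]
    simp only [mul_comm]
  have hY : inner ℝ (L.Y u) (v : L2Field Ω) = ∫ x in Ω,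
      ((inner ℝ (n x) (n x) : ℝ) - 1) * inner ℝ ((v : L2Field Ω) x) ((u : L2Field Ω) x) := by
    rw [L2.inner_def]
    refine integral_congr_ae ?_
    filter_upwards [L.hY u] with x hx
    rw [hx, real_inner_smul_left, real_inner_comm ((v : L2Field Ω) x)]
  have hQ (v : V) : L.Q v =ᵐ[volume.restrict Ω]
      fun x => inner ℝ ((v : L2Field Ω) x) (weakCurl Ω n x) := by
    filter_upwards [L.hQ v] with x hx
    rw [hx, real_inner_comm]
  have hP (v : V) : L.P v =ᵐ[volume.restrict Ω]
      fun x => inner ℝ ((v : L2Field Ω) x) (n x) := by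
    filter_upwards [L.hP v] with x hx
    rw [hx, real_inner_comm]
  have hDv (v : V) : L.D v =ᵐ[volume.restrict Ω] weakDiv Ω v := by rw [L.hD]
  rw [newtonForm, secondVariation, integral_mul_eq_inner (hDv u) (hDv v),
    integral_Zmat_eq_inner _ (L.hN u) (L.hN v), ← hS, ← hS', ← hY,
    integral_mul_eq_inner (L.hN v) (hQ u), integral_mul_eq_inner (L.hN u) (hQ v),
    integral_mul_eq_inner (hQ u) (hQ v), integral_mul_eq_inner (hP u) (hP v), ← L.hC, ← L.hC]
  have e : K₃ * (K₂ / K₃ - 1) = K₂ - K₃ := by field_simp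
  linear_combination e * inner ℝ (L.N u) (L.N v)

theorem newtonRHS_eq (K₁ K₂ : ℝ) {K₃ : ℝ} (hK₃ : K₃ ≠ 0) (ζ : ℝ) {m : L2Scalar Ω} {y : L2Field Ω}
    (hm : m =ᵐ[volume.restrict Ω] fun x => inner ℝ (n x) (weakCurl Ω n x))
    (hy : y =ᵐ[volume.restrict Ω] fun x => ((inner ℝ (n x) (n x) : ℝ) - 1) • n x) (v : V) :
    newtonRHS Ω K₁ K₂ K₃ ζ n v =
      -(K₁ * inner ℝ (weakDiv Ω n) (L.D v) + K₃ * inner ℝ (weakCurl Ω n) (L.C v)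
        + (K₂ - K₃) * (inner ℝ m (L.N v) + inner ℝ m (L.Q v))
        + 2 * ζ * inner ℝ y (v : L2Field Ω)) := by
  have hy' : inner ℝ y (v : L2Field Ω) = ∫ x in Ω,
      inner ℝ ((v : L2Field Ω) x) (n x) * ((inner ℝ (n x) (n x) : ℝ) - 1) := by
    rw [L2.inner_def]
    refine integral_congr_ae ?_
    filter_upwards [hy] with x hx
    rw [hx, real_inner_smul_left, real_inner_comm ((v : L2Field Ω) x), mul_comm]
  have hQ : L.Q v =ᵐ[volume.restrict Ω]
      fun x => inner ℝ ((v : L2Field Ω) x) (weakCurl Ω n x) := by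
    filter_upwards [L.hQ v] with x hx
    rw [hx, real_inner_comm]
  have hDv : L.D v =ᵐ[volume.restrict Ω] weakDiv Ω v := by rw [L.hD]
  rw [newtonRHS, firstVariation, integral_mul_eq_inner (Filter.EventuallyEq.refl _ _) hDv,
    integral_Zmat_eq_inner _ hm (L.hN v), ← hy', integral_mul_eq_inner hm hQ, ← L.hC]
  have e : K₃ * (K₂ / K₃ - 1) = K₂ - K₃ := by field_simp
  linear_combination -e * inner ℝ m (L.N v)

theorem exists_bilin_newtonForm (L : IterateMaps Ω V n) (K₁ K₂ : ℝ) {K₃ : ℝ} (hK₃ : K₃ ≠ 0)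
    (ζ : ℝ) :
    ∃ A : V →ₗ[ℝ] V →ₗ[ℝ] ℝ, ∀ u v : V, A u v = newtonForm Ω K₁ K₂ K₃ ζ n u v := by
  refine ⟨LinearMap.mk₂ ℝ (fun u v : V => newtonForm Ω K₁ K₂ K₃ ζ n u v) ?_ ?_ ?_ ?_,
    fun u v => rfl⟩ <;> intros <;> simp only [L.newtonForm_eq K₁ K₂ hK₃] <;>
  simp only [map_add, map_smul, inner_add_left, inner_add_right,
    real_inner_smul_left, real_inner_smul_right, Submodule.coe_add, Submodule.coe_smul,
    smul_eq_mul] <;> ring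

theorem exists_linear_newtonRHS (L : IterateMaps Ω V n) (K₁ K₂ : ℝ) {K₃ : ℝ}
    (hK₃ : K₃ ≠ 0) (ζ : ℝ) {s : ℝ} (hn : ∀ᵐ x ∂(volume.restrict Ω), ‖n x‖ ≤ s) :
    ∃ f : V →ₗ[ℝ] ℝ, ∀ v : V, f v = newtonRHS Ω K₁ K₂ K₃ ζ n v := by
  have hm := memLp_inner_of_ae_norm_le (f := weakCurl Ω n) hn
  have hy := memLp_inner_self_sub_one_smul hn n
  have e := L.newtonRHS_eq K₁ K₂ hK₃ ζ hm.coeFn_toLp hy.coeFn_toLp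
  refine ⟨{ toFun := fun v => newtonRHS Ω K₁ K₂ K₃ ζ n v, map_add' := ?_, map_smul' := ?_ },
    fun v => rfl⟩ <;> intros <;> simp only [e] <;>
  simp only [map_add, map_smul, inner_add_right, real_inner_smul_right, Submodule.coe_add,
    Submodule.coe_smul, smul_eq_mul, RingHom.id_apply] <;> ring

theorem norm_N_le {s : ℝ} (hn : ∀ᵐ x ∂(volume.restrict Ω), ‖n x‖ ≤ s) (v : V) :
    ‖L.N v‖ ≤ s * ‖weakCurl Ω (v : L2Field Ω)‖ := by
  refine Lp.norm_le_mul_norm_of_ae_le_mul ?_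
  filter_upwards [L.hN v, hn] with x h1 h2
  rw [h1]
  exact (norm_inner_le_norm _ _).trans (by gcongr)

theorem norm_Q_le {v : V} {M : ℝ}
    (hv : ∀ᵐ x ∂(volume.restrict Ω), ‖(v : L2Field Ω) x‖ ≤ M) :
    ‖L.Q v‖ ≤ M * ‖weakCurl Ω n‖ := by
  refine Lp.norm_le_mul_norm_of_ae_le_mul ?_
  filter_upwards [L.hQ v, hv] with x h1 h2
  rw [h1, mul_comm]
  exact (norm_inner_le_norm _ _).trans (by gcongr)

theorem norm_S_le {s : ℝ} (hn : ∀ᵐ x ∂(volume.restrict Ω), ‖n x‖ ≤ s) {v : V} {M : ℝ}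
    (hv : ∀ᵐ x ∂(volume.restrict Ω), ‖(v : L2Field Ω) x‖ ≤ M) :
    ‖L.S v‖ ≤ s * M * ‖weakCurl Ω n‖ := by
  refine Lp.norm_le_mul_norm_of_ae_le_mul ?_
  filter_upwards [L.hS v, hv, hn] with x h1 h2 h3
  rw [h1, norm_smul]
  calc _ ≤ ‖n x‖ * ‖weakCurl Ω n x‖ * ‖(v : L2Field Ω) x‖ := by
        gcongr; exact norm_inner_le_norm _ _
    _ ≤ s * ‖weakCurl Ω n x‖ * M := by
        have := (norm_nonneg _).trans h3
        gcongr
    _ = _ := by ring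

theorem inner_Y_self_ge {α : ℝ} (hn : ∀ᵐ x ∂(volume.restrict Ω), α ≤ ‖n x‖ ^ 2) (v : V) :
    -(|α - 1| * ‖(v : L2Field Ω)‖ ^ 2) ≤ inner ℝ (L.Y v) (v : L2Field Ω) := by
  rw [← real_inner_self_eq_norm_sq, L2.inner_def, L2.inner_def, ← integral_const_mul,
    ← integral_neg]
  refine integral_mono_ae ((L2.integrable_inner _ _).const_mul _).neg (L2.integrable_inner _ _) ?_
  filter_upwards [L.hY v, hn] with x h1 h2
  rw [h1, real_inner_smul_left, real_inner_self_eq_norm_sq, real_inner_self_eq_norm_sq,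
    ← neg_mul]
  gcongr
  linarith [neg_abs_le (α - 1)]

end IterateMaps

end Forms

/-! ### Coercivity -/

section Coercivity

variable {Ω : Set E3}

/-- A Friedrichs constant turns control of divergence and curl into control of `hdcNorm`. -/
theorem IsFriedrichsConst.mul_hdcNorm_sq_le {W : Set (L2Field Ω)} {C K₁ K₃ : ℝ}
    (hC : IsFriedrichsConst Ω W C) (hK₁ : 0 ≤ K₁) (hK₃ : 0 ≤ K₃) {v : L2Field Ω} (hv : v ∈ W) :
    min K₁ K₃ / (C + 1) * hdcNorm Ω v ^ 2
      ≤ K₁ * ‖weakDiv Ω v‖ ^ 2 + K₃ * ‖weakCurl Ω v‖ ^ 2 := by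
  have hC0 : 0 < C + 1 := by linarith [hC.1]
  have h1 : hdcNorm Ω v ^ 2 ≤ (C + 1) * (‖weakDiv Ω v‖ ^ 2 + ‖weakCurl Ω v‖ ^ 2) := by
    rw [hdcNorm_sq]
    linarith [hC.2 v hv]
  calc min K₁ K₃ / (C + 1) * hdcNorm Ω v ^ 2
      ≤ min K₁ K₃ / (C + 1) * ((C + 1) * (‖weakDiv Ω v‖ ^ 2 + ‖weakCurl Ω v‖ ^ 2)) := by
        have := le_min hK₁ hK₃
        gcongr
    _ = min K₁ K₃ * ‖weakDiv Ω v‖ ^ 2 + min K₁ K₃ * ‖weakCurl Ω v‖ ^ 2 := by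
        field_simp
    _ ≤ _ := by
        gcongr
        exacts [min_le_left _ _, min_le_right _ _]

theorem elasticForm_self_of_eq (K₁ : ℝ) {K₃ : ℝ} (hK₃ : K₃ ≠ 0) (n v : L2Field Ω) :
    elasticForm Ω K₁ K₃ K₃ n v v = K₁ * ‖weakDiv Ω v‖ ^ 2 + K₃ * ‖weakCurl Ω v‖ ^ 2 := by
  rw [elasticForm, newtonForm, secondVariation, div_self hK₃, sub_self,
    integral_mul_eq_inner (Filter.EventuallyEq.refl _ _) (Filter.EventuallyEq.refl _ _),
    real_inner_self_eq_norm_sq]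
  simp only [Zmat_mulVec_dotProduct, sub_self, zero_mul, add_zero]
  rw [← L2.inner_def, real_inner_self_eq_norm_sq]
  ring

variable {V : Submodule ℝ (L2Field Ω)} {n : L2Field Ω}

/-- The penalty term lowers the form by at most `2ζ|α - 1|‖v‖²`, since `n · n - 1 ≥ α - 1`. -/
theorem IterateMaps.elasticForm_sub_le_newtonForm (L : IterateMaps Ω V n) (K₁ K₂ : ℝ) {K₃ ζ α : ℝ}
    (hK₃ : K₃ ≠ 0) (hζ : 0 ≤ ζ) (hn : ∀ᵐ x ∂(volume.restrict Ω), α ≤ ‖n x‖ ^ 2) (v : V) :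
    elasticForm Ω K₁ K₂ K₃ n v v - 2 * ζ * |α - 1| * hdcNorm Ω (v : L2Field Ω) ^ 2
      ≤ newtonForm Ω K₁ K₂ K₃ ζ n v v := by
  rw [elasticForm, L.newtonForm_eq K₁ K₂ hK₃, L.newtonForm_eq K₁ K₂ hK₃,
    real_inner_self_eq_norm_sq (L.P v)]
  have h1 := L.inner_Y_self_ge hn v
  have h2 : |α - 1| * ‖(v : L2Field Ω)‖ ^ 2 ≤ |α - 1| * hdcNorm Ω (v : L2Field Ω) ^ 2 := by
    gcongr
    exact norm_le_hdcNorm _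
  have h3 : 0 ≤ 2 * ζ * (inner ℝ (L.Y v) (v : L2Field Ω)
      + |α - 1| * hdcNorm Ω (v : L2Field Ω) ^ 2 + 2 * ‖L.P v‖ ^ 2) := by
    have : 0 ≤ ‖L.P v‖ ^ 2 := sq_nonneg _
    have : 0 ≤ inner ℝ (L.Y v) (v : L2Field Ω)
      + |α - 1| * hdcNorm Ω (v : L2Field Ω) ^ 2 + 2 * ‖L.P v‖ ^ 2 := by linarith
    positivity
  linarith

/-- The terms with the factor `K₂ - K₃`, estimated by Hölder's inequality with `n` and `v` in `L^∞`
and with the curls of `n` and `v` in `L²`. -/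
theorem IterateMaps.elasticForm_ge (L : IterateMaps Ω V n) (K₁ K₂ : ℝ) {K₃ s b R : ℝ}
    (hK₃ : K₃ ≠ 0) (hs : 0 ≤ s) (hb : 0 ≤ b) (hn : ∀ᵐ x ∂(volume.restrict Ω), ‖n x‖ ≤ s)
    (hR : ‖weakCurl Ω n‖ ≤ R) (v : V)
    (hv : ∀ᵐ x ∂(volume.restrict Ω), ‖(v : L2Field Ω) x‖ ≤ b * ‖(v : L2Field Ω)‖) :
    K₁ * ‖weakDiv Ω (v : L2Field Ω)‖ ^ 2 + K₃ * ‖weakCurl Ω (v : L2Field Ω)‖ ^ 2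
      - |K₂ - K₃| * ((s ^ 2 + 4 * (s * b * R) + (b * R) ^ 2) * hdcNorm Ω (v : L2Field Ω) ^ 2)
      ≤ elasticForm Ω K₁ K₂ K₃ n v v := by
  rw [elasticForm, L.newtonForm_eq K₁ K₂ hK₃]
  simp only [real_inner_self_eq_norm_sq, L.hD, L.hC]
  set h := hdcNorm Ω (v : L2Field Ω) with hh
  set c := ‖weakCurl Ω (v : L2Field Ω)‖ with hc
  have hc0 : 0 ≤ c := norm_nonneg _
  have hh0 : 0 ≤ h := hdcNorm_nonneg _
  have hch : c ≤ h := norm_weakCurl_le_hdcNorm _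
  have hvh : ‖(v : L2Field Ω)‖ ≤ h := norm_le_hdcNorm _
  have hR0 : 0 ≤ R := (norm_nonneg _).trans hR
  have hN : ‖L.N v‖ ≤ s * h := (L.norm_N_le hn v).trans (by gcongr)
  have hQ : ‖L.Q v‖ ≤ b * R * h := calc
    _ ≤ b * ‖(v : L2Field Ω)‖ * ‖weakCurl Ω n‖ := L.norm_Q_le hv
    _ ≤ b * h * R := by gcongr
    _ = _ := by ring
  have hS : ‖L.S v‖ ≤ s * b * R * h := calc
    _ ≤ s * (b * ‖(v : L2Field Ω)‖) * ‖weakCurl Ω n‖ := L.norm_S_le hn hv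
    _ ≤ s * (b * h) * R := by gcongr
    _ = _ := by ring
  have t1 : ‖L.N v‖ ^ 2 ≤ s ^ 2 * h ^ 2 := by
    rw [← mul_pow]; gcongr
  have t2 : ‖L.Q v‖ ^ 2 ≤ (b * R) ^ 2 * h ^ 2 := by
    rw [← mul_pow]; gcongr
  have t3 : |inner ℝ (L.S v) (weakCurl Ω (v : L2Field Ω))| ≤ s * b * R * h ^ 2 := calc
    _ ≤ ‖L.S v‖ * c := abs_real_inner_le_norm _ _
    _ ≤ s * b * R * h * h := by gcongr
    _ = _ := by ring
  have t4 : |inner ℝ (L.N v) (L.Q v)| ≤ s * b * R * h ^ 2 := calc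
    _ ≤ ‖L.N v‖ * ‖L.Q v‖ := abs_real_inner_le_norm _ _
    _ ≤ s * h * (b * R * h) := by gcongr
    _ = _ := by ring
  have hbr : |‖L.N v‖ ^ 2 + inner ℝ (L.S v) (weakCurl Ω (v : L2Field Ω)) + inner ℝ (L.N v) (L.Q v)
      + inner ℝ (L.S v) (weakCurl Ω (v : L2Field Ω)) + inner ℝ (L.N v) (L.Q v) + ‖L.Q v‖ ^ 2|
      ≤ (s ^ 2 + 4 * (s * b * R) + (b * R) ^ 2) * h ^ 2 := by
    have := abs_le.1 t3
    have := abs_le.1 t4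
    have : 0 ≤ ‖L.N v‖ ^ 2 := sq_nonneg _
    have : 0 ≤ ‖L.Q v‖ ^ 2 := sq_nonneg _
    rw [abs_le]
    constructor <;> nlinarith
  have hprod := (neg_abs_le _).trans' (neg_le_neg ((abs_mul (K₂ - K₃) _).le.trans
    (mul_le_mul_of_nonneg_left hbr (abs_nonneg (K₂ - K₃)))))
  linarith

end Coercivity

/-! ### Well-posedness of the Newton linearization -/

theorem isWellPosed_newton {Ω : Set E3}
    {V : Submodule ℝ (L2Field Ω)} [FiniteDimensional ℝ V] {n : L2Field Ω}
    (L : IterateMaps Ω V n) (K₁ K₂ : ℝ) {K₃ ζ s c : ℝ} (hK₃ : K₃ ≠ 0)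
    (hn : ∀ᵐ x ∂(volume.restrict Ω), ‖n x‖ ≤ s)
    (hc : IsCoercivityConst Ω V (newtonForm Ω K₁ K₂ K₃ ζ n) c) :
    IsWellPosed Ω V (newtonForm Ω K₁ K₂ K₃ ζ n) (newtonRHS Ω K₁ K₂ K₃ ζ n) :=
  isWellPosed_of_coercive (L.exists_bilin_newtonForm K₁ K₂ hK₃ ζ)
    (L.exists_linear_newtonRHS K₁ K₂ hK₃ ζ hn) hc

theorem IsAdmissibleIterate.ae_norm_le {Ω : Set E3} {α β κ : ℝ} {n : L2Field Ω}
    (h : IsAdmissibleIterate Ω α β κ n) : ∀ᵐ x ∂(volume.restrict Ω), ‖n x‖ ≤ √β := by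
  filter_upwards [h.bounds] with x hx
  exact Real.le_sqrt_of_sq_le hx.2

end PenaltyNewton

theorem mainTheorem1
    (Ω : Set PenaltyNewton.E3) (hΩ_open : IsOpen Ω) (hΩ_bdd : Bornology.IsBounded Ω)
    (hΩ_lip : PenaltyNewton.HasLipschitzBoundary Ω)
    (Vh : Submodule ℝ (PenaltyNewton.L2Field Ω)) [FiniteDimensional ℝ Vh]
    (hVh_sub : (Vh : Set (PenaltyNewton.L2Field Ω)) ⊆ PenaltyNewton.HDC0 Ω)
    (hVh_bdd : ∀ v ∈ Vh, MemLp v ∞ (volume.restrict Ω))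
    (K₁ K₃ ζ α β : ℝ) (hK₁ : 0 ≤ K₁) (hK₃ : 0 < K₃) (hζ : 0 < ζ)
    (hα : 0 < α) (hα_one : α ≤ 1) (hβ_one : 1 ≤ β) :
    -- the constants in the two conditions exist, and do not depend on the discrete space
    (∃ C : ℝ, PenaltyNewton.IsFriedrichsConst Ω (PenaltyNewton.HDC0 Ω) C) ∧
    (0 < K₁ → ∃ α₀ : ℝ, ∀ n : PenaltyNewton.L2Field Ω,
      PenaltyNewton.IsCoercivityConst Ω (PenaltyNewton.HDC0 Ω)
        (PenaltyNewton.elasticForm Ω K₁ K₃ K₃ n) α₀) ∧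
    -- case (i): `κ = 1`
    (∀ (K₂ : ℝ) (n : PenaltyNewton.L2Field Ω) (α₀ : ℝ), K₂ / K₃ = 1 →
      PenaltyNewton.IsAdmissibleIterate Ω α β (K₂ / K₃) n →
      PenaltyNewton.IsCoercivityConst Ω Vh (PenaltyNewton.elasticForm Ω K₁ K₂ K₃ n) α₀ →
      2 * ζ * |α - 1| < α₀ →
      PenaltyNewton.IsWellPosed Ω Vh (PenaltyNewton.newtonForm Ω K₁ K₂ K₃ ζ n)
        (PenaltyNewton.newtonRHS Ω K₁ K₂ K₃ ζ n)) ∧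
    -- case (ii): `κ` in a neighbourhood of `1`, which depends on the iterate only through `β` and
    -- a bound `R` for the norm of its curl
    (∀ C R : ℝ, PenaltyNewton.IsFriedrichsConst Ω Vh C →
      0 < min K₁ K₃ / (C + 1) - 2 * ζ * |α - 1| →
      ∃ ε₁ ε₂ : ℝ, 0 < ε₁ ∧ 0 < ε₂ ∧
        ∀ (K₂ : ℝ) (n : PenaltyNewton.L2Field Ω), 1 - ε₂ < K₂ / K₃ → K₂ / K₃ < 1 + ε₁ →
          PenaltyNewton.IsAdmissibleIterate Ω α β (K₂ / K₃) n →
          ‖PenaltyNewton.weakCurl Ω n‖ ≤ R →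
          PenaltyNewton.IsWellPosed Ω Vh (PenaltyNewton.newtonForm Ω K₁ K₂ K₃ ζ n)
            (PenaltyNewton.newtonRHS Ω K₁ K₂ K₃ ζ n)) := by
  have : IsFiniteMeasure (volume.restrict Ω) :=
    isFiniteMeasure_restrict.2 hΩ_bdd.measure_lt_top.ne
  have hK₃' : K₃ ≠ 0 := hK₃.ne'
  have hVh : (Vh : Set (PenaltyNewton.L2Field Ω)) ⊆ PenaltyNewton.HDC Ω :=
    fun v hv => (hVh_sub hv).1
  obtain ⟨b, hb0, hb⟩ := PenaltyNewton.exists_ae_norm_le Vh hVh_bdd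
  have hmaps {α' β' κ : ℝ} {n : PenaltyNewton.L2Field Ω}
      (h : PenaltyNewton.IsAdmissibleIterate Ω α' β' κ n) :
      Nonempty (PenaltyNewton.IterateMaps Ω Vh n) :=
    PenaltyNewton.exists_iterateMaps hΩ_open hVh (fun v hv => ⟨_, hb v hv⟩) h.ae_norm_le
  obtain ⟨C₀, hC₀⟩ := PenaltyNewton.exists_isFriedrichsConst hΩ_bdd hΩ_open.measurableSet
  refine ⟨⟨C₀, hC₀⟩, fun hK₁' => ?_, ?_, ?_⟩
  · refine ⟨min K₁ K₃ / (C₀ + 1), fun n => ⟨?_, fun v hv => ?_⟩⟩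
    · exact div_pos (lt_min hK₁' hK₃) (by linarith [hC₀.1])
    · rw [PenaltyNewton.elasticForm_self_of_eq K₁ hK₃']
      exact hC₀.mul_hdcNorm_sq_le hK₁ hK₃.le hv
  · intro K₂ n α₀ hκ hn hα₀ hlt
    obtain ⟨L⟩ := hmaps hn
    refine PenaltyNewton.isWellPosed_newton L K₁ K₂ hK₃' hn.ae_norm_le
      (c := α₀ - 2 * ζ * |α - 1|) ⟨by linarith, fun v hv => ?_⟩
    have h1 := L.elasticForm_sub_le_newtonForm K₁ K₂ hK₃' hζ.le
      (hn.bounds.mono fun x hx => hx.1) ⟨v, hv⟩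
    have h2 := hα₀.2 v hv
    rw [sub_mul]
    exact (sub_le_sub_right h2 _).trans h1
  · intro C R hC hβ₁
    set β₁ := min K₁ K₃ / (C + 1) - 2 * ζ * |α - 1| with hβ₁_def
    set D := √β ^ 2 + 4 * (√β * b * |R|) + (b * |R|) ^ 2 with hD
    have hD0 : 0 ≤ D := by positivity
    -- for this `ε`, the terms with the factor `K₂ - K₃` use up at most half of `β₁`
    set ε := β₁ / (2 * K₃ * (D + 1)) with hε
    have hε0 : 0 < ε := by positivity
    refine ⟨ε, ε, hε0, hε0, fun K₂ n hκ₁ hκ₂ hn hnR => ?_⟩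
    obtain ⟨L⟩ := hmaps hn
    have hK₂ : |K₂ - K₃| * D ≤ β₁ / 2 := by
      have e : K₂ - K₃ = K₃ * (K₂ / K₃ - 1) := by field_simp
      have h1 : |K₂ / K₃ - 1| ≤ ε := abs_le.2 ⟨by linarith, by linarith⟩
      calc |K₂ - K₃| * D = K₃ * |K₂ / K₃ - 1| * D := by rw [e, abs_mul, abs_of_pos hK₃]
        _ ≤ K₃ * ε * (D + 1) := by gcongr; linarith
        _ = β₁ / 2 := by rw [hε]; field_simp
    refine PenaltyNewton.isWellPosed_newton L K₁ K₂ hK₃' hn.ae_norm_le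
      (c := β₁ / 2) ⟨by positivity, fun v hv => ?_⟩
    have h1 := L.elasticForm_sub_le_newtonForm K₁ K₂ hK₃' hζ.le
      (hn.bounds.mono fun x hx => hx.1) ⟨v, hv⟩
    have h2 := L.elasticForm_ge K₁ K₂ hK₃' (Real.sqrt_nonneg β) hb0 hn.ae_norm_le
      (hnR.trans (le_abs_self R)) ⟨v, hv⟩ (hb v hv)
    have h3 := hC.mul_hdcNorm_sq_le hK₁ hK₃.le (v := v) hv
    have h4 := mul_le_mul_of_nonneg_right hK₂ (sq_nonneg (PenaltyNewton.hdcNorm Ω v))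
    rw [← hD] at h2
    have h5 : β₁ * PenaltyNewton.hdcNorm Ω v ^ 2 = min K₁ K₃ / (C + 1) *
        PenaltyNewton.hdcNorm Ω v ^ 2 - 2 * ζ * |α - 1| * PenaltyNewton.hdcNorm Ω v ^ 2 := by
      rw [hβ₁_def, sub_mul]
    simp only at h1 h2
    linarith
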